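/- Let $k$ be an algebraically closed field and $n\ge 1$. **Arcs.** Let $\mathbb{A}(n)$ be the annulus with $n$ marked points $0,1,\dots,n-1$ on its outer boundary, realised as the cylinder $\mathbb{R}/n\mathbb{Z}\times[0,1]$ with marked points $(i \bmod n,0)$, and let $\pi_n:\mathbb{R}\times[0,1]\to\mathbb{A}(n)$, $(x,y)\mapsto(x\bmod n,y)$, be its universal covering. For integers $a,b$ with $a+1<b$ let $[a,b]$ be the oriented arc from $(a,0)$ to $(b,0)$ in $\mathbb{R}\times[0,1]$ (unique up to homotopy fixing the end points). The admissible arcs in $\mathbb{A}(n)$ are the homotopy classes (fixing the end points) $\pi_n([a,b])$ with $a+1<b$. The translation quiver $\Gamma(\mathbb{A}(n))$ has the admissible arcs in $\mathbb{A}(n)$ as vertices; there is one arrow from $\alpha$ to $\beta$ if there are integers $a+1<b$ and $c+1<d$ with $\alpha=\pi_n([a,b])$, $\beta=\pi_n([c,d])$ and either $(c,d)=(a+1,b)$ or $(c,d)=(a,b+1)$, and no arrow otherwise; its translation is $\tau\,\pi_n([a,b])=\pi_n([a-1,b-1])$. **The tube.** Let $\mathcal{T}_n$ be the category of finite-dimensional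 nilpotent representations over $k$ of the cyclically oriented quiver with vertex set $\mathbb{Z}/n$ and arrows $i+1\to i$, and let $S_i$ be the simple object at the vertex $i$. The AR-quiver $\Gamma_{\mathcal{T}_n}$ has as vertices the isomorphism classes of indecomposable objects of $\mathcal{T}_n$, has $\dim_k \operatorname{rad}(X,Y)/\operatorname{rad}^2(X,Y)$ arrows from $X$ to $Y$, and its translation $\tau$ is the AR-translate: $\tau Z=X$ if there is an almost split sequence $0\to X\to E\to Z\to 0$. For integers $a,b$ with $a+1<b$ let $M[a,b]$ be the indecomposable object, unique up to isomorphism, which has a composition series with factors $S_{a+1},S_{a+2},\dots,S_{b-1}$, ordered from the socle upwards, indices being taken modulo $n$. **Lemma.** $\Gamma(\mathbb{A}(n))$ and $\Gamma_{\mathcal{T}_n}$ are stable translation quivers, and they are isomorphic as stable translation quivers: there is an isomorphism $\varphi:\Gamma(\mathbb{A}(n))\to\Gamma_{\mathcal{T}_n}$ (a bijection on vertices that preserves the number of arrows between any two vertices and commutes with $\tau$) which is given on vertices by $\pi_n([a,b])\mapsto M[a,b]$ for all integers $a,b$ with $a+1<b$. -/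

import Mathlib

open CategoryTheory CategoryTheory.Limits

universe u v w

noncomputable section

/-! ### Translation quivers -/

/-- A quiver, given by its vertices and the number of arrows between any two of them, together
with a relation `trans x y`, to be read as "the translation `τ x` of `x` is defined and equal to
`y`". -/
structure TransQuiver where
  V : Type u
  arrows : V → V → ℕ
  trans : V → V → Prop

/-- The defining properties of a stable translation quiver: it is locally finite and without loops,
the translation is a (graph of an everywhere defined) bijection `τ` of the set of vertices, and
for all vertices `x`, `z` there are as many arrows from `z` to `x` as from `τ x` to `z`. -/
structure TransQuiver.IsStable (Q : TransQuiver.{u}) : Prop where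
  no_loops : ∀ x, Q.arrows x x = 0
  finite_succ : ∀ x, {y | Q.arrows x y ≠ 0}.Finite
  finite_pred : ∀ x, {y | Q.arrows y x ≠ 0}.Finite
  trans_total : ∀ x, ∃! y, Q.trans x y
  trans_bijective : ∀ y, ∃! x, Q.trans x y
  mesh : ∀ x y, Q.trans x y → ∀ z, Q.arrows z x = Q.arrows y z

/-- Isomorphisms of (stable) translation quivers: bijections on vertices which preserve the number
of arrows and the translation. -/
structure TransQuiver.Iso (P : TransQuiver.{u}) (Q : TransQuiver.{v}) where
  toEquiv : P.V ≃ Q.V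
  arrows_eq : ∀ x y, Q.arrows (toEquiv x) (toEquiv y) = P.arrows x y
  trans_iff : ∀ x y, Q.trans (toEquiv x) (toEquiv y) ↔ P.trans x y

/-! ### Arcs in the annulus -/

/-- Oriented arcs in a space `X` up to homotopy fixing the end points: a starting point, an end
point, and a homotopy class of paths. -/
def OrientedArc (X : Type u) [TopologicalSpace X] : Type u :=
  Σ p : X × X, Path.Homotopic.Quotient p.1 p.2

/-- The image of an oriented arc (up to homotopy) under a continuous map. -/
def OrientedArc.map {X : Type u} {Y : Type v} [TopologicalSpace X] [TopologicalSpace Y]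
    (f : C(X, Y)) (α : OrientedArc X) : OrientedArc Y :=
  ⟨(f α.1.1, f α.1.2), α.2.map f⟩

/-- The infinite strip `{(x, y) | 0 ≤ y ≤ 1}`. -/
abbrev Strip : Type := ℝ × unitInterval

/-- The annulus, as the cylinder of circumference `n` and height `1`. -/
abbrev Cyl (n : ℕ) : Type := AddCircle (n : ℝ) × unitInterval

/-- The universal covering `(x, y) ↦ (x mod n, y)` of the annulus by the strip. -/
def coverMap (n : ℕ) : C(Strip, Cyl n) where
  toFun p := ((p.1 : AddCircle (n : ℝ)), p.2)
  continuous_toFun :=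
    ((AddCircle.continuous_mk' (n : ℝ)).comp continuous_fst).prodMk continuous_snd

/-- The marked point `(i, 0)` on the lower boundary of the strip. -/
def mark (i : ℤ) : Strip := ((i : ℝ), 0)

/-- The straight path in the strip from the marked point `i` to the marked point `j`. -/
def straightPath (i j : ℤ) : Path (mark i) (mark j) :=
  (Path.segment (i : ℝ) (j : ℝ)).prod (Path.refl 0)

/-- The oriented arc `[i, j]` in the strip. -/
def stripArc (i j : ℤ) : OrientedArc Strip :=
  ⟨(mark i, mark j), Path.Homotopic.Quotient.mk (straightPath i j)⟩

/-- Up to homotopy, `[i, j]` is the only oriented arc in the strip from the marked point `i` to the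
marked point `j`. -/
theorem stripArc_unique (i j : ℤ) (γ : Path (mark i) (mark j)) :
    (⟨(mark i, mark j), Path.Homotopic.Quotient.mk γ⟩ : OrientedArc Strip) = stripArc i j := by
  have : ContractibleSpace unitInterval :=
    (convex_Icc (0 : ℝ) 1).contractibleSpace ⟨0, by simp⟩
  have : ContractibleSpace Strip := inferInstance
  have h : Path.Homotopic.Quotient.mk γ = Path.Homotopic.Quotient.mk (straightPath i j) :=
    Path.Homotopic.Quotient.eq.mpr (SimplyConnectedSpace.paths_homotopic _ _)
  unfold stripArc
  rw [h]

/-- The projection `π_n([i, j])` of the arc `[i, j]` to the annulus. -/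
def projArc (n : ℕ) (i j : ℤ) : OrientedArc (Cyl n) :=
  (stripArc i j).map (coverMap n)

/-- The admissible arcs in the annulus with `n` marked points on its outer boundary. -/
def AdmArc (n : ℕ) : Type :=
  {α : OrientedArc (Cyl n) // ∃ i j : ℤ, i + 1 < j ∧ α = projArc n i j}

/-- `π_n([i, j])` as an admissible arc. -/
def AdmArc.proj (n : ℕ) (i j : ℤ) (h : i + 1 < j) : AdmArc n :=
  ⟨projArc n i j, i, j, h, rfl⟩

/-- There is an arrow from `α` to `β` in the arc quiver: `α` and `β` have lifts `[a, b]` and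
`[c, d]` (both admissible) which differ by moving one end point one step to the right. -/
def AdmArc.HasArrow {n : ℕ} (α β : AdmArc n) : Prop :=
  ∃ (a b c d : ℤ) (h : a + 1 < b) (h' : c + 1 < d),
    AdmArc.proj n a b h = α ∧ AdmArc.proj n c d h' = β ∧
      ((c = a + 1 ∧ d = b) ∨ (c = a ∧ d = b + 1))

open Classical in
/-- The translation quiver of admissible arcs in the annulus. The translation is induced by the map
`i ↦ i - 1` on marked points, i.e. it takes `π_n([a, b])` to `π_n([a - 1, b - 1])`. -/
def arcQuiver (n : ℕ) : TransQuiver.{0} where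
  V := AdmArc n
  arrows α β := if α.HasArrow β then 1 else 0
  trans α β := ∃ (a b : ℤ) (h : a + 1 < b),
    α = AdmArc.proj n a b h ∧ β = AdmArc.proj n (a - 1) (b - 1) (by omega)

/-! ### The tube: nilpotent representations of a cyclic quiver -/

/-- The endomorphism of `⨁ i, V i` (for `i` in `ℤ/n`) given by the action of all arrows of a cyclic
quiver. Its `m`-th power is given by the action of all paths of length `m`. -/
def totalMap {k : Type u} [Field k] {n : ℕ} {V : ZMod n → Type u} [∀ i, AddCommGroup (V i)]
    [∀ i, Module k (V i)] (f : ∀ i, V (i + 1) →ₗ[k] V i) : Module.End k (∀ i, V i) :=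
  LinearMap.pi fun i => f i ∘ₗ LinearMap.proj (i + 1)

/-- Finite-dimensional nilpotent representations over `k` of the cyclically oriented quiver with
vertices the elements of `ℤ/n` and one arrow `i + 1 ⟶ i` for every `i`. Nilpotent: all
sufficiently long paths act as zero. -/
structure NilRep (k : Type u) [Field k] (n : ℕ) where
  V : ZMod n → Type u
  [addCommGroup : ∀ i, AddCommGroup (V i)]
  [module : ∀ i, Module k (V i)]
  [finiteDimensional : ∀ i, FiniteDimensional k (V i)]
  act : ∀ i, V (i + 1) →ₗ[k] V i
  nilpotent : IsNilpotent (totalMap act)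

namespace NilRep

variable {k : Type u} [Field k] {n : ℕ}

attribute [instance] NilRep.addCommGroup NilRep.module NilRep.finiteDimensional

/-- Morphisms of representations: families of linear maps commuting with the action of the
arrows. -/
def homSubmodule (X Y : NilRep k n) : Submodule k (∀ i, X.V i →ₗ[k] Y.V i) where
  carrier := {f | ∀ i, f i ∘ₗ X.act i = Y.act i ∘ₗ f (i + 1)}
  add_mem' {f g} hf hg i := by
    simp only [Set.mem_ofPred_eq] at hf hg
    simp only [Pi.add_apply, LinearMap.add_comp, LinearMap.comp_add, hf i, hg i]
  zero_mem' i := by simp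
  smul_mem' c f hf i := by
    simp only [Set.mem_ofPred_eq] at hf
    simp only [Pi.smul_apply, LinearMap.smul_comp, LinearMap.comp_smul, hf i]

instance : Category (NilRep k n) where
  Hom X Y := homSubmodule X Y
  id X := ⟨fun _ => LinearMap.id, fun _ => by simp⟩
  comp f g := ⟨fun i => g.1 i ∘ₗ f.1 i, fun i => by
    rw [LinearMap.comp_assoc, f.2 i, ← LinearMap.comp_assoc, g.2 i, LinearMap.comp_assoc]⟩

/-- The component at the vertex `i` of a morphism of representations. -/
def comp {X Y : NilRep k n} (f : X ⟶ Y) (i : ZMod n) : X.V i →ₗ[k] Y.V i := f.1 i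

theorem hom_ext {X Y : NilRep k n} {f g : X ⟶ Y} (h : ∀ i, comp f i = comp g i) : f = g :=
  Subtype.ext (funext h)

theorem comp_act {X Y : NilRep k n} (f : X ⟶ Y) (i : ZMod n) :
    comp f i ∘ₗ X.act i = Y.act i ∘ₗ comp f (i + 1) := f.2 i

instance (X Y : NilRep k n) : AddCommGroup (X ⟶ Y) :=
  inferInstanceAs (AddCommGroup (homSubmodule X Y))

instance (X Y : NilRep k n) : Module k (X ⟶ Y) :=
  inferInstanceAs (Module k (homSubmodule X Y))

@[simp] theorem comp_comp {X Y Z : NilRep k n} (f : X ⟶ Y) (g : Y ⟶ Z) (i : ZMod n) :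
    comp (f ≫ g) i = comp g i ∘ₗ comp f i := rfl

@[simp] theorem comp_id (X : NilRep k n) (i : ZMod n) : comp (𝟙 X) i = LinearMap.id := rfl

@[simp] theorem comp_add {X Y : NilRep k n} (f g : X ⟶ Y) (i : ZMod n) :
    comp (f + g) i = comp f i + comp g i := rfl

@[simp] theorem comp_zero {X Y : NilRep k n} (i : ZMod n) : comp (0 : X ⟶ Y) i = 0 := rfl

@[simp] theorem comp_smul {X Y : NilRep k n} (c : k) (f : X ⟶ Y) (i : ZMod n) :
    comp (c • f) i = c • comp f i := rfl

instance : Preadditive (NilRep k n) where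
  add_comp _ _ _ f f' g := hom_ext fun i => by simp [LinearMap.comp_add]
  comp_add _ _ _ f g g' := hom_ext fun i => by simp [LinearMap.add_comp]

instance : Linear k (NilRep k n) where
  smul_comp _ _ _ c f g := hom_ext fun i => by simp [LinearMap.comp_smul]
  comp_smul _ _ _ f c g := hom_ext fun i => by simp [LinearMap.smul_comp]

/-- The direct sum of two representations. -/
def directSum (X Y : NilRep k n) : NilRep k n where
  V i := X.V i × Y.V i
  act i := (X.act i).prodMap (Y.act i)
  nilpotent := by
    obtain ⟨a, ha⟩ := X.nilpotent
    obtain ⟨b, hb⟩ := Y.nilpotent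
    have key : ∀ (m : ℕ) (v : ∀ i, X.V i × Y.V i),
        (totalMap (fun i => (X.act i).prodMap (Y.act i)) ^ m) v =
          fun i => ((totalMap X.act ^ m) (fun i => (v i).1) i,
            (totalMap Y.act ^ m) (fun i => (v i).2) i) := by
      intro m
      induction m with
      | zero => intro v; rfl
      | succ m ih =>
        intro v
        rw [pow_succ, Module.End.mul_apply, ih, pow_succ, pow_succ]
        rfl
    refine ⟨a + b, LinearMap.ext fun v => ?_⟩
    rw [key, pow_add, pow_add, ha, hb]
    simp
    rfl

instance : HasBinaryBiproducts (NilRep k n) where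
  has_binary_biproduct X Y := hasBinaryBiproduct_of_total
    { pt := directSum X Y
      fst := ⟨fun _ => LinearMap.fst k _ _, fun _ => rfl⟩
      snd := ⟨fun _ => LinearMap.snd k _ _, fun _ => rfl⟩
      inl := ⟨fun _ => LinearMap.inl k _ _, fun i => LinearMap.ext fun x =>
        Prod.ext rfl ((Y.act i).map_zero).symm⟩
      inr := ⟨fun _ => LinearMap.inr k _ _, fun i => LinearMap.ext fun x =>
        Prod.ext ((X.act i).map_zero).symm rfl⟩
      inl_fst := rfl
      inl_snd := rfl
      inr_fst := rfl
      inr_snd := rfl }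
    (hom_ext fun i => LinearMap.ext fun x => Prod.ext (add_zero _) (zero_add _))

/-- The simple representation `S_j`: it is `k` at the vertex `j`, zero at all other vertices, and
all arrows act as zero. -/
def simple (k : Type u) [Field k] {n : ℕ} (j : ZMod n) : NilRep k n where
  V i := ↥(if i = j then ⊤ else ⊥ : Submodule k k)
  act _ := 0
  nilpotent := ⟨1, by rw [pow_one]; rfl⟩

/-- The sequence of representations `0 ⟶ X ⟶ Y ⟶ Z ⟶ 0` given by `f` and `g` is exact. -/
structure IsShortExact {X Y Z : NilRep k n} (f : X ⟶ Y) (g : Y ⟶ Z) : Prop where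
  injective : ∀ i, Function.Injective (comp f i)
  exact : ∀ i, LinearMap.ker (comp g i) = LinearMap.range (comp f i)
  surjective : ∀ i, Function.Surjective (comp g i)

/-- `M` has a composition series with composition factors, ordered from the socle upwards, the
simple representations `S_{s 0}, S_{s 1}, …, S_{s (m-1)}`: there is a chain of subobjects
`0 = F 0 ⊆ F 1 ⊆ … ⊆ F m = M` with `F (t+1) / F t ≅ S_{s t}`. -/
def HasCompositionSeries (M : NilRep k n) (m : ℕ) (s : Fin m → ZMod n) : Prop :=
  ∃ F : ℕ → NilRep k n, IsZero (F 0) ∧ Nonempty (F m ≅ M) ∧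
    ∀ t : Fin m, ∃ (f : F t ⟶ F (t + 1)) (g : F (t + 1) ⟶ simple k (s t)), IsShortExact f g

/-! ### The Auslander-Reiten quiver of the tube -/

/-- The exact sequence `0 ⟶ X ⟶ E ⟶ Z ⟶ 0` given by `f` and `g` is an almost split sequence. -/
structure IsAlmostSplit {X E Z : NilRep k n} (f : X ⟶ E) (g : E ⟶ Z) : Prop where
  shortExact : IsShortExact f g
  indecomposable_left : Indecomposable X
  indecomposable_right : Indecomposable Z
  not_splitMono : ¬ IsSplitMono f
  left_almost_split : ∀ (W : NilRep k n) (h : X ⟶ W), ¬ IsSplitMono h → ∃ h' : E ⟶ W, f ≫ h' = h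
  not_splitEpi : ¬ IsSplitEpi g
  right_almost_split : ∀ (W : NilRep k n) (h : W ⟶ Z), ¬ IsSplitEpi h → ∃ h' : W ⟶ E, h' ≫ g = h

/-- The radical `rad(X, Y)` of the category: all `f : X ⟶ Y` such that `1 - g f` is invertible for
every `g : Y ⟶ X`. If `X` and `Y` are indecomposable, these are the non-isomorphisms. -/
def rad (X Y : NilRep k n) : Submodule k (X ⟶ Y) where
  carrier := {f | ∀ g : Y ⟶ X, IsIso (𝟙 X - f ≫ g)}
  add_mem' {f f'} hf hf' g := by
    have := hf g
    have := hf' (g ≫ inv (𝟙 X - f ≫ g))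
    have : 𝟙 X - (f + f') ≫ g =
        (𝟙 X - f' ≫ g ≫ inv (𝟙 X - f ≫ g)) ≫ (𝟙 X - f ≫ g) := by
      rw [Preadditive.sub_comp, Category.id_comp, Category.assoc, Category.assoc,
        IsIso.inv_hom_id, Category.comp_id, Preadditive.add_comp, sub_sub]
    rw [this]
    infer_instance
  zero_mem' g := by
    rw [zero_comp, sub_zero]
    infer_instance
  smul_mem' c f hf g := by
    have := hf (c • g)
    rwa [Linear.comp_smul, ← Linear.smul_comp] at this

/-- The square of the radical: it is spanned by all compositions of two radical morphisms. If `X`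
and `Y` are indecomposable, the irreducible morphisms from `X` to `Y` are the morphisms which are
in `rad X Y`, but not in `radSq X Y`. -/
def radSq (X Y : NilRep k n) : Submodule k (X ⟶ Y) :=
  Submodule.span k {h | ∃ (Z : NilRep k n) (f : X ⟶ Z) (g : Z ⟶ Y),
    f ∈ rad X Z ∧ g ∈ rad Z Y ∧ h = f ≫ g}

/-- The dimension of the space `rad(X, Y) / rad²(X, Y)` of irreducible morphisms. -/
def irrDim (X Y : NilRep k n) : ℕ :=
  Module.finrank k (↥(rad X Y) ⧸ (radSq X Y).submoduleOf (rad X Y))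

/-- Composition with isomorphisms on both sides, as a linear equivalence of `Hom` spaces. -/
def homCongr {X X' Y Y' : NilRep k n} (e : X ≅ X') (e' : Y ≅ Y') : (X ⟶ Y) ≃ₗ[k] (X' ⟶ Y') where
  toFun f := e.inv ≫ f ≫ e'.hom
  invFun f := e.hom ≫ f ≫ e'.inv
  map_add' f g := by simp
  map_smul' c f := by simp
  left_inv f := by simp
  right_inv f := by simp

theorem homCongr_mem_rad {X X' Y Y' : NilRep k n} (e : X ≅ X') (e' : Y ≅ Y') {f : X ⟶ Y}
    (hf : f ∈ rad X Y) : homCongr e e' f ∈ rad X' Y' := by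
  intro g
  have := hf (e'.hom ≫ g ≫ e.inv)
  have : 𝟙 X' - homCongr e e' f ≫ g = e.inv ≫ (𝟙 X - f ≫ e'.hom ≫ g ≫ e.inv) ≫ e.hom := by
    simp [homCongr]
  rw [this]
  infer_instance

theorem map_rad {X X' Y Y' : NilRep k n} (e : X ≅ X') (e' : Y ≅ Y') :
    (rad X Y).map (homCongr e e' : (X ⟶ Y) →ₗ[k] (X' ⟶ Y')) = rad X' Y' := by
  ext f
  constructor
  · rintro ⟨f, hf, rfl⟩
    exact homCongr_mem_rad e e' hf
  · intro hf
    refine ⟨homCongr e.symm e'.symm f, homCongr_mem_rad e.symm e'.symm hf, ?_⟩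
    simp [homCongr]

theorem homCongr_mem_radSq {X X' Y Y' : NilRep k n} (e : X ≅ X') (e' : Y ≅ Y') {f : X ⟶ Y}
    (hf : f ∈ radSq X Y) : homCongr e e' f ∈ radSq X' Y' := by
  have h : radSq X Y ≤ (radSq X' Y').comap (homCongr e e' : (X ⟶ Y) →ₗ[k] (X' ⟶ Y')) := by
    refine Submodule.span_le.mpr ?_
    rintro _ ⟨Z, f, g, hf, hg, rfl⟩
    refine Submodule.subset_span ⟨Z, homCongr e (Iso.refl Z) f, homCongr (Iso.refl Z) e' g,
      homCongr_mem_rad _ _ hf, homCongr_mem_rad _ _ hg, ?_⟩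
    simp [homCongr]
  exact h hf

theorem irrDim_congr {X X' Y Y' : NilRep k n} (e : X ≅ X') (e' : Y ≅ Y') :
    irrDim X Y = irrDim X' Y' := by
  let φ : ↥(rad X Y) ≃ₗ[k] ↥(rad X' Y') :=
    (homCongr e e').ofSubmodules (rad X Y) (rad X' Y') (map_rad e e')
  refine LinearEquiv.finrank_eq (Submodule.Quotient.equiv _ _ φ ?_)
  ext f
  constructor
  · rintro ⟨f, hf, rfl⟩
    exact homCongr_mem_radSq e e' hf
  · intro hf
    refine ⟨φ.symm f, ?_, φ.apply_symm_apply f⟩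
    exact homCongr_mem_radSq e.symm e'.symm hf

/-- Isomorphism of indecomposable representations. -/
def indSetoid (k : Type u) [Field k] (n : ℕ) :
    Setoid {X : NilRep k n // Indecomposable X} where
  r X Y := Nonempty (X.1 ≅ Y.1)
  iseqv := ⟨fun _ => ⟨Iso.refl _⟩, fun ⟨e⟩ => ⟨e.symm⟩, fun ⟨e⟩ ⟨e'⟩ => ⟨e ≪≫ e'⟩⟩

/-- The isomorphism classes of indecomposable objects of the tube. -/
def Ind (k : Type u) [Field k] (n : ℕ) : Type (u + 1) :=
  Quotient (indSetoid k n)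

/-- The isomorphism class of an indecomposable object. -/
def Ind.mk (X : NilRep k n) (hX : Indecomposable X) : Ind k n :=
  Quotient.mk (indSetoid k n) ⟨X, hX⟩

end NilRep

/-- The Auslander-Reiten quiver of the tube of rank `n`: its vertices are the isomorphism classes of
indecomposable objects, the number of arrows from `[X]` to `[Y]` is the dimension of
`rad(X, Y) / rad²(X, Y)`, and the translate of `[Z]` is `[X]` if there is an almost split sequence
`0 ⟶ X ⟶ E ⟶ Z ⟶ 0`. -/
def arQuiver (k : Type u) [Field k] (n : ℕ) : TransQuiver.{u + 1} where
  V := NilRep.Ind k n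
  arrows := Quotient.lift₂ (fun X Y => NilRep.irrDim X.1 Y.1)
    fun _ _ _ _ ⟨e⟩ ⟨e'⟩ => NilRep.irrDim_congr e e'
  trans z x := ∃ (X E Z : NilRep k n) (hX : Indecomposable X) (hZ : Indecomposable Z)
    (f : X ⟶ E) (g : E ⟶ Z), NilRep.IsAlmostSplit f g ∧
      x = NilRep.Ind.mk X hX ∧ z = NilRep.Ind.mk Z hZ

end

/-! Both quivers are identified with the combinatorial tube `tubeQuiver n`, whose vertices are pairs
(socle, length minus one). Stability is checked there and transported, and the required isomorphism
is the composite of the two identifications.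

For arcs, `π_n([a, b])` is determined by `a` mod `n` and `b - a` (`projArc_eq_iff`): translating a
lift by a multiple of `n` does not change its projection, and conversely unique path lifting
recovers the end point of a lift from its starting point.

For representations, all arrows together form one nilpotent operator `shift` on the total space. The
model `uniserial k j l` consists of finitely supported sequences under the left shift, cut up by
vertices. Morphisms out of it are given by the image of a generator (`fromTop`), morphisms into it
by a functional at the vertex `j` (`toSoc`). If `l > 0`, its socle is a line spanned by `basisVec k
j l 0`, so injectivity of a map out of it, and invertibility of an endomorphism, can be tested on
this one vector. Where a path of maximal length acts nontrivially, `fromTop` and `toSoc` split off a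
uniserial summand (`exists_retract`); hence every indecomposable is uniserial.

The same splitting argument shows that a map out of `uniserial k j (l + 1)` which is not a split
monomorphism factors through the inclusion into length `l + 2` and the quotient by the socle
(`exists_factor_left`), and dually for maps into it (`exists_factor_right`). This yields the almost
split sequences, hence `τ`. Applied to radical maps, it also computes `rad/rad²`: only scalar
multiples of inclusions and socle quotients survive. Finally, the bottom composition factor and the
length identify a uniserial object, which matches it with `M[a, b]`. -/

noncomputable section

/-! ### Total spaces, kernels and short exact sequences -/

namespace NilRep

variable {k : Type u} [Field k] {n : ℕ}

/-- The total space of a representation. -/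
abbrev Tot (X : NilRep k n) : Type u := ∀ i, X.V i

/-- The action of all arrows on the total space. -/
abbrev shift (X : NilRep k n) : Module.End k X.Tot := totalMap X.act

theorem shift_apply (X : NilRep k n) (v : X.Tot) (i : ZMod n) :
    X.shift v i = X.act i (v (i + 1)) := rfl

theorem shift_single (X : NilRep k n) (i : ZMod n) (w : X.V (i + 1)) :
    X.shift (Pi.single (i + 1) w) = Pi.single i (X.act i w) := by
  funext i'
  rw [shift_apply]
  by_cases h : i' = i
  · subst h
    simp
  · rw [Pi.single_eq_of_ne h, Pi.single_eq_of_ne (fun h' => h (add_right_cancel h')), map_zero]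

/-- A path of length `m` ending at `i` starts at `i + m`, so no other component of the vector can
contribute. -/
theorem shift_pow_apply_congr (X : NilRep k n) (m : ℕ) {i : ZMod n} {v w : X.Tot}
    (h : v (i + m) = w (i + m)) : (X.shift ^ m) v i = (X.shift ^ m) w i := by
  induction m generalizing v w with
  | zero =>
    -- The fibres over `i` and `i + 0` are different types; generalising the index lets `rfl`
    -- eliminate the equation without casts.
    have : ∀ p, p = i + ((0 : ℕ) : ZMod n) → v p = w p := by
      rintro _ rfl
      exact h
    exact this i (by simp)
  | succ m ih =>
    rw [pow_succ, Module.End.mul_apply, Module.End.mul_apply]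
    apply ih
    rw [shift_apply, shift_apply]
    have : ∀ p, p = i + ((m + 1 : ℕ) : ZMod n) → v p = w p := by
      rintro _ rfl
      exact h
    rw [this _ (by push_cast; ring)]

/-- The map of total spaces induced by a morphism. -/
def totMap {X Y : NilRep k n} (f : X ⟶ Y) : X.Tot →ₗ[k] Y.Tot :=
  LinearMap.pi fun i => comp f i ∘ₗ LinearMap.proj i

@[simp] theorem totMap_apply {X Y : NilRep k n} (f : X ⟶ Y) (v : X.Tot) (i : ZMod n) :
    totMap f v i = comp f i (v i) := rfl

theorem totMap_single {X Y : NilRep k n} (f : X ⟶ Y) (i : ZMod n) (w : X.V i) :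
    totMap f (Pi.single i w) = Pi.single i (comp f i w) := by
  funext i'
  by_cases h : i' = i
  · subst h
    simp
  · simp [h]

theorem totMap_comp {X Y Z : NilRep k n} (f : X ⟶ Y) (g : Y ⟶ Z) (v : X.Tot) :
    totMap (f ≫ g) v = totMap g (totMap f v) := rfl

@[simp] theorem totMap_id (X : NilRep k n) (v : X.Tot) : totMap (𝟙 X) v = v := rfl

@[simp] theorem totMap_add {X Y : NilRep k n} (f g : X ⟶ Y) (v : X.Tot) :
    totMap (f + g) v = totMap f v + totMap g v := rfl

@[simp] theorem totMap_zero {X Y : NilRep k n} (v : X.Tot) : totMap (0 : X ⟶ Y) v = 0 := rfl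

@[simp] theorem totMap_smul {X Y : NilRep k n} (c : k) (f : X ⟶ Y) (v : X.Tot) :
    totMap (c • f) v = c • totMap f v := rfl

@[simp] theorem totMap_sub {X Y : NilRep k n} (f g : X ⟶ Y) (v : X.Tot) :
    totMap (f - g) v = totMap f v - totMap g v := by
  rw [eq_sub_iff_add_eq, ← totMap_add, sub_add_cancel]

@[simp] theorem totMap_neg {X Y : NilRep k n} (f : X ⟶ Y) (v : X.Tot) :
    totMap (-f) v = - totMap f v := by
  rw [eq_neg_iff_add_eq_zero, ← totMap_add, neg_add_cancel, totMap_zero]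

theorem comp_act_apply {X Y : NilRep k n} (f : X ⟶ Y) (i : ZMod n) (x : X.V (i + 1)) :
    comp f i (X.act i x) = Y.act i (comp f (i + 1) x) :=
  LinearMap.congr_fun (comp_act f i) x

theorem totMap_shift {X Y : NilRep k n} (f : X ⟶ Y) (v : X.Tot) :
    totMap f (X.shift v) = Y.shift (totMap f v) :=
  funext fun i => comp_act_apply f i (v (i + 1))

theorem totMap_shift_pow {X Y : NilRep k n} (f : X ⟶ Y) (m : ℕ) (v : X.Tot) :
    totMap f ((X.shift ^ m) v) = (Y.shift ^ m) (totMap f v) := by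
  induction m generalizing v with
  | zero => rfl
  | succ m ih => rw [pow_succ, pow_succ, Module.End.mul_apply, Module.End.mul_apply, ih,
      totMap_shift]

theorem hom_ext_totMap {X Y : NilRep k n} {f g : X ⟶ Y} (h : ∀ v, totMap f v = totMap g v) :
    f = g :=
  hom_ext fun i => LinearMap.ext fun x => by simpa using congrFun (h (Pi.single i x)) i

theorem isIso_of_bijective {X Y : NilRep k n} (f : X ⟶ Y)
    (h : ∀ i, Function.Bijective (comp f i)) : IsIso f := by
  let e := fun i => LinearEquiv.ofBijective (comp f i) (h i)
  have he : ∀ i x, comp f i ((e i).symm x) = x := fun i x => (e i).apply_symm_apply x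
  let g : Y ⟶ X := ⟨fun i => (e i).symm, fun i => LinearMap.ext fun y => (h i).1 (by
    simp [he, comp_act_apply])⟩
  exact ⟨g, hom_ext fun i => LinearMap.ext fun x => (e i).symm_apply_apply x,
    hom_ext fun i => LinearMap.ext fun x => he i x⟩

theorem totMap_injective_of_isSplitMono {X Y : NilRep k n} (f : X ⟶ Y) [IsSplitMono f] :
    Function.Injective (totMap f) := fun v w h => by
  have h' := congrArg (totMap (retraction f)) h
  rwa [← totMap_comp, ← totMap_comp, IsSplitMono.id] at h'

theorem totMap_surjective_of_isSplitEpi {X Y : NilRep k n} (f : X ⟶ Y) [IsSplitEpi f] :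
    Function.Surjective (totMap f) := fun v =>
  ⟨totMap (section_ f) v, by rw [← totMap_comp, IsSplitEpi.id]; rfl⟩

theorem comp_injective_iff {X Y : NilRep k n} (f : X ⟶ Y) :
    (∀ i, Function.Injective (comp f i)) ↔ Function.Injective (totMap f) := by
  constructor
  · exact fun h v w hvw => funext fun i => h i (congrFun hvw i)
  · intro h i x y hxy
    have := @h (Pi.single i x) (Pi.single i y) (by rw [totMap_single, totMap_single, hxy])
    simpa using congrFun this i

theorem comp_surjective_iff {X Y : NilRep k n} (f : X ⟶ Y) :
    (∀ i, Function.Surjective (comp f i)) ↔ Function.Surjective (totMap f) := by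
  constructor
  · intro h v
    choose g hg using h
    exact ⟨fun i => g i (v i), funext fun i => hg i (v i)⟩
  · intro h i x
    obtain ⟨v, hv⟩ := h (Pi.single i x)
    exact ⟨v i, by simpa using congrFun hv i⟩

/-- An injective endomorphism is an isomorphism. -/
theorem isIso_of_injective {X : NilRep k n} (f : X ⟶ X) (h : Function.Injective (totMap f)) :
    IsIso f :=
  isIso_of_bijective f fun i => ⟨(comp_injective_iff f).2 h i,
    LinearMap.surjective_of_injective ((comp_injective_iff f).2 h i)⟩

/-- A surjective endomorphism is an isomorphism. -/
theorem isIso_of_surjective {X : NilRep k n} (f : X ⟶ X) (h : Function.Surjective (totMap f)) :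
    IsIso f :=
  isIso_of_bijective f fun i =>
    ⟨LinearMap.injective_iff_surjective.2 ((comp_surjective_iff f).2 h i),
      (comp_surjective_iff f).2 h i⟩

theorem isZero_iff (X : NilRep k n) : IsZero X ↔ ∀ v : X.Tot, v = 0 := by
  rw [IsZero.iff_id_eq_zero]
  constructor
  · intro h v
    rw [← totMap_id X v, h, totMap_zero]
  · exact fun h => hom_ext_totMap fun v => by rw [h v, map_zero, map_zero]

/-- The kernel of a morphism of representations. -/
def kernelRep {X Y : NilRep k n} (f : X ⟶ Y) : NilRep k n where
  V i := LinearMap.ker (comp f i)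
  act i := (X.act i).restrict fun x hx => by
    rw [LinearMap.mem_ker, comp_act_apply, LinearMap.mem_ker.1 hx, map_zero]
  nilpotent := by
    obtain ⟨a, ha⟩ := X.nilpotent
    refine ⟨a, LinearMap.ext fun v => funext fun i => Subtype.ext ?_⟩
    have key : ∀ (m : ℕ) (v : ∀ i, LinearMap.ker (comp f i)) (i : ZMod n),
        (((totalMap (fun i => (X.act i).restrict (p := LinearMap.ker (comp f (i + 1)))
          (q := LinearMap.ker (comp f i)) fun x hx => by
            rw [LinearMap.mem_ker, comp_act_apply, LinearMap.mem_ker.1 hx, map_zero]) ^ m) v i :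
          LinearMap.ker (comp f i)) : X.V i) = (X.shift ^ m) (fun i => (v i : X.V i)) i := by
      intro m
      induction m with
      | zero => intro v i; rfl
      | succ m ih =>
        intro v i
        rw [pow_succ, Module.End.mul_apply, ih, pow_succ]
        rfl
    rw [key, shift, ha]
    rfl

/-- The inclusion of the kernel. -/
def kernelRep.ι {X Y : NilRep k n} (f : X ⟶ Y) : kernelRep f ⟶ X :=
  ⟨fun i => (LinearMap.ker (comp f i)).subtype, fun _ => rfl⟩

/-- The universal property of the kernel. -/
def kernelRep.lift {W X Y : NilRep k n} (f : X ⟶ Y) (h : W ⟶ X) (hh : h ≫ f = 0) :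
    W ⟶ kernelRep f :=
  ⟨fun i => (comp h i).codRestrict _ fun x => by
    rw [LinearMap.mem_ker, ← LinearMap.comp_apply, ← comp_comp, hh]; rfl,
    fun i => LinearMap.ext fun x => Subtype.ext (comp_act_apply h i x)⟩

theorem kernelRep.lift_ι {W X Y : NilRep k n} (f : X ⟶ Y) (h : W ⟶ X) (hh : h ≫ f = 0) :
    kernelRep.lift f h hh ≫ kernelRep.ι f = h := rfl

theorem kernelRep.ι_comp {X Y : NilRep k n} (f : X ⟶ Y) : kernelRep.ι f ≫ f = 0 :=
  hom_ext fun _ => LinearMap.ext fun x => LinearMap.mem_ker.1 x.2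

/-- A nonzero direct summand of an indecomposable representation is the whole representation. -/
theorem nonempty_iso_of_retract {X Y : NilRep k n} (hX : Indecomposable X) (hY : ¬ IsZero Y)
    (s : Y ⟶ X) (r : X ⟶ Y) (h : s ≫ r = 𝟙 Y) : Nonempty (X ≅ Y) := by
  -- The complement of the idempotent `r ≫ s` lands in the kernel of `r`, so `X` is the biproduct of
  -- `Y` and that kernel; indecomposability then kills the kernel.
  have hp : (𝟙 X - r ≫ s) ≫ r = 0 := by
    rw [Preadditive.sub_comp, Category.assoc, h]; simp
  have hι := kernelRep.ι_comp r
  have hs : s ≫ kernelRep.lift r _ hp = 0 := by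
    refine hom_ext fun i => LinearMap.ext fun x => Subtype.ext ?_
    have : s ≫ (𝟙 X - r ≫ s) = 0 := by
      rw [Preadditive.comp_sub, ← Category.assoc, h]; simp
    exact LinearMap.congr_fun (congrArg (fun f => comp f i) this) x
  have hι' : kernelRep.ι r ≫ kernelRep.lift r _ hp = 𝟙 _ := by
    refine hom_ext fun i => LinearMap.ext fun x => Subtype.ext ?_
    have : kernelRep.ι r ≫ (𝟙 X - r ≫ s) = kernelRep.ι r := by
      rw [Preadditive.comp_sub, ← Category.assoc, hι]; simp
    exact LinearMap.congr_fun (congrArg (fun f => comp f i) this) x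
  let e : X ≅ Y ⊞ kernelRep r :=
    { hom := biprod.lift r (kernelRep.lift r _ hp)
      inv := biprod.desc s (kernelRep.ι r)
      hom_inv_id := by
        rw [biprod.lift_desc, kernelRep.lift_ι]; abel
      inv_hom_id := by
        apply biprod.hom_ext' <;> apply biprod.hom_ext <;> simp [h, hι, hs, hι'] }
  have hK : IsZero (kernelRep r) := (hX.2 _ _ e).resolve_left hY
  refine ⟨⟨r, s, ?_, h⟩⟩
  have := kernelRep.lift_ι r _ hp
  rw [hK.eq_of_src (kernelRep.ι r) 0, Limits.comp_zero] at this
  exact (sub_eq_zero.1 this.symm).symm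

/-- Linear sections `σ i` of `g` need not commute with the arrows, but `t ∘ σ` does, because `t`
ignores the kernel of `g`. -/
theorem exists_desc_of_surjective {Y Z W : NilRep k n} (g : Y ⟶ Z)
    (hg : Function.Surjective (totMap g)) (t : Y ⟶ W)
    (ht : ∀ v, totMap g v = 0 → totMap t v = 0) : ∃ s : Z ⟶ W, g ≫ s = t := by
  have hg' := (comp_surjective_iff g).2 hg
  choose σ hσ using fun i => (comp g i).exists_rightInverse_of_surjective
    (LinearMap.range_eq_top.2 (hg' i))
  have key : ∀ i y, comp t i (σ i (comp g i y)) = comp t i y := by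
    intro i y
    have h0 : comp g i (σ i (comp g i y) - y) = 0 := by
      rw [map_sub, ← LinearMap.comp_apply (comp g i), hσ]
      simp
    have := congrFun (ht (Pi.single i (σ i (comp g i y) - y))
      (by rw [totMap_single, h0, Pi.single_zero])) i
    rw [totMap_single, Pi.single_eq_same, map_sub] at this
    exact sub_eq_zero.1 this
  refine ⟨⟨fun i => comp t i ∘ₗ σ i, fun i => LinearMap.ext fun z => ?_⟩,
    hom_ext fun i => LinearMap.ext fun y => key i y⟩
  obtain ⟨y, rfl⟩ := hg' _ z
  simp only [LinearMap.comp_apply]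
  rw [← comp_act_apply, key, key, comp_act_apply]

/-- Preimages under `f` are unique, which forces the pointwise choice to be linear and compatible
with the arrows. -/
theorem exists_lift_of_injective {X Y W : NilRep k n} (f : X ⟶ Y)
    (hf : Function.Injective (totMap f)) (t : W ⟶ Y)
    (ht : ∀ w, ∃ x, totMap f x = totMap t w) : ∃ s : W ⟶ X, s ≫ f = t := by
  have hf' := (comp_injective_iff f).2 hf
  have hr : ∀ i w, ∃ x, comp f i x = comp t i w := by
    intro i w
    obtain ⟨x, hx⟩ := ht (Pi.single i w)
    refine ⟨x i, ?_⟩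
    have := congrFun hx i
    rwa [totMap_single, Pi.single_eq_same] at this
  choose σ hσ using hr
  refine ⟨⟨fun i => ⟨⟨σ i, fun x y => hf' i ?_⟩, fun c x => hf' i ?_⟩,
    fun i => LinearMap.ext fun x => hf' i ?_⟩, hom_ext fun i => LinearMap.ext (hσ i)⟩
  · simp [hσ]
  · simp [hσ]
  · simp [hσ, comp_act_apply]

/-- Short exactness in terms of total spaces. -/
theorem isShortExact_iff {X Y Z : NilRep k n} {f : X ⟶ Y} {g : Y ⟶ Z} :
    IsShortExact f g ↔ Function.Injective (totMap f) ∧ Function.Surjective (totMap g) ∧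
      ∀ v, totMap g v = 0 ↔ ∃ u, totMap f u = v := by
  constructor
  · intro h
    refine ⟨(comp_injective_iff f).1 h.injective, (comp_surjective_iff g).1 h.surjective,
      fun v => ⟨fun hv => ?_, ?_⟩⟩
    · have : ∀ i, ∃ u, comp f i u = v i := fun i => by
        rw [← LinearMap.mem_range, ← h.exact]
        exact congrFun hv i
      choose u hu using this
      exact ⟨u, funext hu⟩
    · rintro ⟨u, rfl⟩
      funext i
      change comp f i (u i) ∈ LinearMap.ker (comp g i)
      rw [h.exact]
      exact ⟨u i, rfl⟩
  · rintro ⟨h₁, h₂, h₃⟩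
    refine ⟨(comp_injective_iff f).2 h₁, fun i => ?_, (comp_surjective_iff g).2 h₂⟩
    ext x
    rw [LinearMap.mem_ker, LinearMap.mem_range]
    have := h₃ (Pi.single i x)
    rw [totMap_single, Pi.single_eq_zero_iff] at this
    rw [this]
    constructor
    · rintro ⟨u, hu⟩
      exact ⟨u i, by simpa using congrFun hu i⟩
    · rintro ⟨u, rfl⟩
      exact ⟨Pi.single i u, totMap_single f i u⟩

namespace IsShortExact

variable {X Y Z W : NilRep k n} {f : X ⟶ Y} {g : Y ⟶ Z}

theorem comp_eq_zero (h : IsShortExact f g) : f ≫ g = 0 :=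
  hom_ext_totMap fun v => ((isShortExact_iff.1 h).2.2 _).2 ⟨v, rfl⟩

theorem exists_desc (h : IsShortExact f g) (t : Y ⟶ W) (ht : f ≫ t = 0) :
    ∃ s : Z ⟶ W, g ≫ s = t := by
  obtain ⟨-, h₂, h₃⟩ := isShortExact_iff.1 h
  refine exists_desc_of_surjective g h₂ t fun v hv => ?_
  obtain ⟨u, rfl⟩ := (h₃ v).1 hv
  rw [← totMap_comp, ht, totMap_zero]

theorem exists_lift (h : IsShortExact f g) (t : W ⟶ Y) (ht : t ≫ g = 0) :
    ∃ s : W ⟶ X, s ≫ f = t := by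
  obtain ⟨h₁, -, h₃⟩ := isShortExact_iff.1 h
  exact exists_lift_of_injective f h₁ t fun w => (h₃ _).1 (by rw [← totMap_comp, ht, totMap_zero])

end IsShortExact

end NilRep

/-! ### Uniserial representations, and the maps out of and into them -/

namespace NilRep

variable {k : Type u} [Field k] {n : ℕ}

/-- The sequences in `k` which are the elements of the uniserial representation with socle at `j`
and length `l` at the vertex `i`. -/
def uniserialSpace (k : Type u) [Field k] {n : ℕ} (j : ZMod n) (l : ℕ) (i : ZMod n) :
    Submodule k (ℕ → k) where
  carrier := {v | ∀ t, v t ≠ 0 → t < l ∧ j + t = i}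
  add_mem' {v w} hv hw t h := by
    by_cases h' : v t = 0
    · exact hw t fun h'' => h (by simp [h', h''])
    · exact hv t h'
  zero_mem' t h := absurd rfl h
  smul_mem' c v hv t h := hv t fun h' => h (by simp [h'])

theorem uniserialSpace_apply_eq_zero {j : ZMod n} {l : ℕ} {i : ZMod n}
    (v : uniserialSpace k j l i) {t : ℕ} (h : ¬ (t < l ∧ j + t = i)) : v.1 t = 0 := by
  by_contra h'
  exact h (v.2 t h')

instance (j : ZMod n) (l : ℕ) (i : ZMod n) : FiniteDimensional k (uniserialSpace k j l i) := by
  refine Module.Finite.of_injective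
    (LinearMap.pi (fun t : Fin l => LinearMap.proj (t : ℕ) ∘ₗ (uniserialSpace k j l i).subtype) :
      uniserialSpace k j l i →ₗ[k] (Fin l → k)) fun v w h => Subtype.ext (funext fun t => ?_)
  by_cases ht : t < l
  · exact congrFun h ⟨t, ht⟩
  · rw [uniserialSpace_apply_eq_zero _ (fun h => ht h.1),
      uniserialSpace_apply_eq_zero _ (fun h => ht h.1)]

/-- The shift of sequences. -/
def seqShift (k : Type u) [Field k] : (ℕ → k) →ₗ[k] (ℕ → k) where
  toFun v t := v (t + 1)
  map_add' _ _ := rfl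
  map_smul' _ _ := rfl

/-- The uniserial representation of length `l` with socle `S_j`. Its elements are sequences
supported in `[0, l)`, the arrows act by shifting sequences to the left. -/
def uniserial (k : Type u) [Field k] {n : ℕ} (j : ZMod n) (l : ℕ) : NilRep k n where
  V i := uniserialSpace k j l i
  act i := (seqShift k).restrict fun v hv t h => by
    obtain ⟨h₁, h₂⟩ := hv (t + 1) h
    refine ⟨by omega, add_right_cancel (b := 1) ?_⟩
    rw [← h₂]
    push_cast
    ring
  nilpotent := by
    refine ⟨l, LinearMap.ext fun v => funext fun i => Subtype.ext (funext fun t => ?_)⟩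
    have key : ∀ (m : ℕ) (v : ∀ i, uniserialSpace k j l i) (i : ZMod n) (t : ℕ),
        ((totalMap (fun i => (seqShift k).restrict (p := uniserialSpace k j l (i + 1))
          (q := uniserialSpace k j l i) fun v hv t h => by
            obtain ⟨h₁, h₂⟩ := hv (t + 1) h
            refine ⟨by omega, add_right_cancel (b := 1) ?_⟩
            rw [← h₂]
            push_cast
            ring) ^ m) v i).1 t = (v (i + m)).1 (t + m) := by
      intro m
      induction m with
      | zero =>
        intro v i t
        have : ∀ p, p = i → (v i).1 t = (v p).1 t := by rintro _ rfl; rfl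
        exact this _ (by simp)
      | succ m ih =>
        intro v i t
        rw [pow_succ, Module.End.mul_apply, ih]
        have : ∀ p, p = i + ((m + 1 : ℕ) : ZMod n) →
            (v p).1 (t + m + 1) = (v (i + ((m + 1 : ℕ) : ZMod n))).1 (t + m + 1) := by
          rintro _ rfl; rfl
        exact this _ (by push_cast; ring)
    rw [key, uniserialSpace_apply_eq_zero _ fun h => by omega]
    rfl

variable {j : ZMod n} {l : ℕ}

/-- An element of a uniserial representation as a sequence. -/
def uval (i : ZMod n) : (uniserial k j l).V i →ₗ[k] (ℕ → k) := (uniserialSpace k j l i).subtype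

theorem uval_injective (i : ZMod n) : Function.Injective (uval (k := k) (j := j) (l := l) i) :=
  Subtype.val_injective

theorem uval_act (i : ZMod n) (v : (uniserial k j l).V (i + 1)) (t : ℕ) :
    uval i ((uniserial k j l).act i v) t = uval (i + 1) v (t + 1) := rfl

theorem uval_eq_zero {i : ZMod n} (v : (uniserial k j l).V i) {t : ℕ} (h : ¬ (t < l ∧ j + t = i)) :
    uval i v t = 0 := uniserialSpace_apply_eq_zero (l := l) v h

/-- The `t`-th coefficient of an element of the total space of a uniserial representation. -/
def coeff (t : ℕ) : (uniserial k j l).Tot →ₗ[k] k :=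
  LinearMap.proj t ∘ₗ uval (j + (t : ZMod n)) ∘ₗ LinearMap.proj (j + (t : ZMod n))

theorem coeff_apply (t : ℕ) (v : (uniserial k j l).Tot) :
    coeff t v = uval (j + (t : ZMod n)) (v (j + t)) t := rfl

theorem uval_apply_of_eq (v : (uniserial k j l).Tot) {i : ZMod n} {t : ℕ} (h : j + t = i) :
    uval i (v i) t = coeff t v := by
  subst h
  rfl

theorem coeff_zero_congr {v w : (uniserial k j l).Tot} (h : v j = w j) :
    coeff 0 v = coeff 0 w := by
  rw [← uval_apply_of_eq v (i := j) (by simp), ← uval_apply_of_eq w (i := j) (by simp), h]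

theorem coeff_eq_zero (v : (uniserial k j l).Tot) {t : ℕ} (h : l ≤ t) : coeff t v = 0 :=
  uval_eq_zero _ fun h' => by omega

theorem tot_ext {v w : (uniserial k j l).Tot} (h : ∀ t < l, coeff t v = coeff t w) : v = w := by
  funext i
  refine uval_injective i (funext fun t => ?_)
  by_cases ht : t < l ∧ j + t = i
  · rw [uval_apply_of_eq _ ht.2, uval_apply_of_eq _ ht.2, h t ht.1]
  · rw [uval_eq_zero _ ht, uval_eq_zero _ ht]

theorem coeff_shift (t : ℕ) (v : (uniserial k j l).Tot) :
    coeff t ((uniserial k j l).shift v) = coeff (t + 1) v := by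
  rw [coeff_apply, shift_apply, uval_act]
  exact uval_apply_of_eq v (by push_cast; ring)

theorem coeff_shift_pow (t m : ℕ) (v : (uniserial k j l).Tot) :
    coeff t (((uniserial k j l).shift ^ m) v) = coeff (t + m) v := by
  induction m generalizing v with
  | zero => rfl
  | succ m ih => rw [pow_succ, Module.End.mul_apply, ih, coeff_shift, add_assoc]

theorem shift_pow_uniserial (v : (uniserial k j l).Tot) : ((uniserial k j l).shift ^ l) v = 0 :=
  tot_ext fun t _ => by rw [coeff_shift_pow, coeff_eq_zero _ (by omega), map_zero]

/-- The basis vectors of a uniserial representation. -/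
def basisVec (k : Type u) [Field k] {n : ℕ} (j : ZMod n) (l t : ℕ) : (uniserial k j l).Tot :=
  open Classical in fun i => (⟨fun s => if s = t ∧ t < l ∧ j + t = i then 1 else 0, fun s hs => by
    by_contra h
    refine hs (if_neg ?_)
    rintro ⟨rfl, h'⟩
    exact h h'⟩ : uniserialSpace k j l i)

theorem coeff_basisVec {t : ℕ} (ht : t < l) (s : ℕ) :
    coeff s (basisVec k j l t) = if s = t then 1 else 0 := by
  by_cases h : s = t
  · subst h
    exact (if_pos ⟨rfl, ht, rfl⟩).trans (if_pos rfl).symm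
  · exact (if_neg fun h' => h h'.1).trans (if_neg h).symm

theorem basisVec_eq_single (t : ℕ) :
    basisVec k j l t = Pi.single (j + t) (basisVec k j l t (j + t)) := by
  funext i
  by_cases h : i = j + t
  · subst h
    simp
  · rw [Pi.single_eq_of_ne h]
    refine uval_injective i (funext fun s => if_neg fun h' => h h'.2.2.symm)

theorem shift_pow_basisVec {t m : ℕ} (h : t + m < l) :
    ((uniserial k j l).shift ^ m) (basisVec k j l (t + m)) = basisVec k j l t :=
  tot_ext fun s _ => by
    rw [coeff_shift_pow, coeff_basisVec h, coeff_basisVec (by omega)]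
    simp

theorem basisVec_ne_zero {t : ℕ} (h : t < l) : basisVec k j l t ≠ 0 := fun h' => by
  have := congrArg (coeff t) h'
  rw [coeff_basisVec h, map_zero, if_pos rfl] at this
  exact one_ne_zero this

theorem eq_sum_basisVec (v : (uniserial k j l).Tot) :
    v = ∑ t ∈ Finset.range l, coeff t v • basisVec k j l t := by
  refine tot_ext fun s hs => ?_
  rw [map_sum, Finset.sum_eq_single_of_mem s (Finset.mem_range.2 hs)]
  · rw [map_smul, coeff_basisVec hs, if_pos rfl, smul_eq_mul, mul_one]
  · intro t ht hst
    rw [map_smul, coeff_basisVec (Finset.mem_range.1 ht), if_neg hst.symm, smul_zero]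

theorem eq_smul_of_shift_eq_zero {v : (uniserial k j l).Tot}
    (h : (uniserial k j l).shift v = 0) : v = coeff 0 v • basisVec k j l 0 := by
  refine tot_ext fun s hs => ?_
  rw [map_smul, coeff_basisVec (by omega)]
  cases s with
  | zero => simp
  | succ s => rw [← coeff_shift, h]; simp

theorem shift_pow_single_of_ne (W : NilRep k n) (m : ℕ) {i p : ZMod n} (h : i + m ≠ p)
    (x : W.V p) : (W.shift ^ m) (Pi.single p x) i = 0 := by
  rw [shift_pow_apply_congr (w := 0) W m (by rw [Pi.single_eq_of_ne h]; rfl), map_zero]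
  rfl

/-- The morphism from a uniserial representation which takes its generator to a given element. -/
def fromTop {W : NilRep k n} (x : W.V (j + l))
    (hx : (W.shift ^ (l + 1)) (Pi.single (j + l) x) = 0) : uniserial k j (l + 1) ⟶ W :=
  ⟨fun i => ∑ t ∈ Finset.range (l + 1),
    ((LinearMap.proj t ∘ₗ uval i).smulRight ((W.shift ^ (l - t)) (Pi.single (j + l) x) i)),
    fun i => by
    refine LinearMap.ext fun v => ?_
    simp only [LinearMap.comp_apply, LinearMap.sum_apply, LinearMap.smulRight_apply,
      LinearMap.proj_apply, uval_act, map_sum, map_smul]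
    -- The two sums agree up to an index shift. The extra term on the left has a coefficient beyond
    -- the support; the extra term on the right is a path of length `l + 1` applied to `x`, zero by
    -- `hx`.
    rw [Finset.sum_range_succ, Finset.sum_range_succ', uval_eq_zero v (t := l + 1) (by omega),
      zero_smul, add_zero, ← shift_apply, ← Module.End.mul_apply, ← pow_succ']
    simp only [Nat.sub_zero]
    rw [hx, Pi.zero_apply, smul_zero, add_zero]
    refine Finset.sum_congr rfl fun t ht => ?_
    have := Finset.mem_range.1 ht
    rw [← shift_apply, ← Module.End.mul_apply, ← pow_succ', show l - (t + 1) + 1 = l - t by omega]⟩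

theorem totMap_fromTop {W : NilRep k n} (x : W.V (j + l))
    (hx : (W.shift ^ (l + 1)) (Pi.single (j + l) x) = 0) :
    totMap (fromTop x hx) (basisVec k j (l + 1) l) = Pi.single (j + l) x := by
  funext i
  change (∑ t ∈ Finset.range (l + 1), ((LinearMap.proj t ∘ₗ uval i).smulRight
    ((W.shift ^ (l - t)) (Pi.single (j + l) x) i)) : _ →ₗ[k] _) _ = _
  simp only [LinearMap.comp_apply, LinearMap.sum_apply, LinearMap.smulRight_apply,
      LinearMap.proj_apply]
  by_cases h : j + l = i
  · rw [Finset.sum_eq_single_of_mem l (Finset.self_mem_range_succ l), uval_apply_of_eq _ h,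
      coeff_basisVec (by omega)]
    · simp
    · intro t ht htl
      by_cases h' : j + t = i
      · rw [uval_apply_of_eq _ h', coeff_basisVec (by omega), if_neg htl, zero_smul]
      · rw [uval_eq_zero _ (by tauto), zero_smul]
  · rw [Pi.single_eq_of_ne (Ne.symm h)]
    refine Finset.sum_eq_zero fun t _ => ?_
    rw [basisVec_eq_single, Pi.single_eq_of_ne (Ne.symm h), map_zero, Pi.zero_apply, zero_smul]

/-- The last basis vector generates: its images under powers of `shift` are all the others. -/
theorem hom_ext_top {W : NilRep k n} {f g : uniserial k j (l + 1) ⟶ W}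
    (h : totMap f (basisVec k j (l + 1) l) = totMap g (basisVec k j (l + 1) l)) : f = g := by
  refine hom_ext_totMap fun v => ?_
  rw [eq_sum_basisVec v, map_sum, map_sum]
  refine Finset.sum_congr rfl fun t ht => ?_
  have := Finset.mem_range.1 ht
  obtain ⟨m, rfl⟩ : ∃ m, l = t + m := ⟨l - t, by omega⟩
  rw [map_smul, map_smul, ← shift_pow_basisVec (t := t) (m := m) (by omega), totMap_shift_pow,
    totMap_shift_pow, h]

/-- The morphism to a uniserial representation given by a functional. -/
def toSoc {W : NilRep k n} (ξ : W.V j →ₗ[k] k) (hξ : ∀ v, ξ ((W.shift ^ l) v j) = 0) :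
    W ⟶ uniserial k j l :=
  ⟨fun i => LinearMap.codRestrict (uniserialSpace k j l i) (LinearMap.pi fun t =>
      ξ ∘ₗ LinearMap.proj j ∘ₗ (W.shift ^ t) ∘ₗ LinearMap.single k W.V i) fun x t ht => by
    simp only [LinearMap.pi_apply, LinearMap.comp_apply, LinearMap.proj_apply,
      LinearMap.single_apply] at ht
    constructor
    · by_contra h
      obtain ⟨m, rfl⟩ : ∃ m, t = l + m := ⟨t - l, by omega⟩
      rw [pow_add, Module.End.mul_apply, hξ] at ht
      exact ht rfl
    · by_contra h
      rw [shift_pow_single_of_ne W t h, map_zero] at ht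
      exact ht rfl, fun i => LinearMap.ext fun x => Subtype.ext (funext fun t => by
    change ξ ((W.shift ^ t) (Pi.single i (W.act i x)) j) =
      ξ ((W.shift ^ (t + 1)) (Pi.single (i + 1) x) j)
    rw [pow_succ, Module.End.mul_apply, shift_single])⟩

theorem coeff_toSoc {W : NilRep k n} (ξ : W.V j →ₗ[k] k) (hξ : ∀ v, ξ ((W.shift ^ l) v j) = 0)
    (t : ℕ) (v : W.Tot) : coeff t (totMap (toSoc ξ hξ) v) = ξ ((W.shift ^ t) v j) := by
  change ξ ((W.shift ^ t) (Pi.single (j + t) (v (j + t))) j) = _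
  rw [shift_pow_apply_congr]
  simp

/-- Dual to `hom_ext_top`: every coefficient is the zeroth coefficient after a power of `shift`. -/
theorem hom_ext_soc {W : NilRep k n} {f g : W ⟶ uniserial k j l}
    (h : ∀ v, coeff 0 (totMap f v) = coeff 0 (totMap g v)) : f = g := by
  refine hom_ext_totMap fun v => tot_ext fun t _ => ?_
  rw [← zero_add t, ← coeff_shift_pow, ← coeff_shift_pow, ← totMap_shift_pow, ← totMap_shift_pow, h]

/-- The inclusion of a uniserial representation into the next longer one. -/
def incl (k : Type u) [Field k] {n : ℕ} (j : ZMod n) (l : ℕ) :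
    uniserial k j l ⟶ uniserial k j (l + 1) :=
  ⟨fun i => Submodule.inclusion (p := uniserialSpace k j l i) (p' := uniserialSpace k j (l + 1) i)
    fun _ hv t ht => ⟨(hv t ht).1.trans (Nat.lt_succ_self l), (hv t ht).2⟩, fun _ => rfl⟩

@[simp] theorem coeff_incl (t : ℕ) (v : (uniserial k j l).Tot) :
    coeff t (totMap (incl k j l) v) = coeff t v := rfl

/-- The quotient of a uniserial representation by its socle. -/
def quot (k : Type u) [Field k] {n : ℕ} (j : ZMod n) (l : ℕ) :
    uniserial k j (l + 1) ⟶ uniserial k (j + 1) l :=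
  ⟨fun i => (seqShift k).restrict (p := uniserialSpace k j (l + 1) i)
    (q := uniserialSpace k (j + 1) l i) fun v hv t ht => by
      obtain ⟨h₁, h₂⟩ := hv (t + 1) ht
      refine ⟨by omega, ?_⟩
      rw [← h₂]
      push_cast
      ring, fun _ => rfl⟩

@[simp] theorem coeff_quot (t : ℕ) (v : (uniserial k j (l + 1)).Tot) :
    coeff t (totMap (quot k j l) v) = coeff (t + 1) v :=
  uval_apply_of_eq v (by push_cast; ring)

/-! ### Socles, and the classification of indecomposable representations -/

theorem exists_shift_pow_ne_zero (X : NilRep k n) {v : X.Tot} (hv : v ≠ 0) :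
    ∃ t, (X.shift ^ t) v ≠ 0 ∧ X.shift ((X.shift ^ t) v) = 0 := by
  classical
  have h : ∃ m, (X.shift ^ m) v = 0 := by
    obtain ⟨m, hm⟩ := X.nilpotent
    exact ⟨m, by rw [shift, hm]; rfl⟩
  obtain ⟨t, ht⟩ : ∃ t, Nat.find h = t + 1 := Nat.exists_eq_succ_of_ne_zero fun h0 => hv (by
    have := Nat.find_spec h
    rwa [h0] at this)
  refine ⟨t, Nat.find_min h (by omega), ?_⟩
  rw [← Module.End.mul_apply, ← pow_succ', ← ht]
  exact Nat.find_spec h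

/-- The socle is essential: the last nonzero vector in the orbit of `v` is killed by `shift`, and
that kernel is spanned by the basis vector at `0`. -/
theorem exists_shift_pow_eq_basisVec {v : (uniserial k j l).Tot} (hv : v ≠ 0) :
    ∃ (t : ℕ) (c : k), c ≠ 0 ∧ ((uniserial k j l).shift ^ t) v = c • basisVec k j l 0 := by
  obtain ⟨t, ht, ht'⟩ := exists_shift_pow_ne_zero _ hv
  have := eq_smul_of_shift_eq_zero ht'
  refine ⟨t, _, fun h => ht ?_, this⟩
  rw [this, h, zero_smul]

/-- A morphism which does not kill the socle is injective. -/
theorem injective_of_ne_zero {W : NilRep k n} (f : uniserial k j l ⟶ W)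
    (h : totMap f (basisVec k j l 0) ≠ 0) : Function.Injective (totMap f) := by
  rw [← LinearMap.ker_eq_bot, LinearMap.ker_eq_bot']
  intro v hv
  by_contra hv'
  obtain ⟨t, c, hc, ht⟩ := exists_shift_pow_eq_basisVec hv'
  have := congrArg (totMap f) ht
  rw [totMap_shift_pow, hv, map_zero, map_smul] at this
  exact smul_ne_zero hc h this.symm

/-- A nonzero morphism hits the socle. -/
theorem exists_totMap_eq_basisVec {W : NilRep k n} (f : W ⟶ uniserial k j l) {w : W.Tot}
    (h : totMap f w ≠ 0) : ∃ w', totMap f w' = basisVec k j l 0 := by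
  obtain ⟨t, c, hc, ht⟩ := exists_shift_pow_eq_basisVec h
  exact ⟨c⁻¹ • (W.shift ^ t) w, by rw [map_smul, totMap_shift_pow, ht, inv_smul_smul₀ hc]⟩

theorem shift_basisVec_zero : (uniserial k j l).shift (basisVec k j l 0) = 0 := by
  refine tot_ext fun t ht => ?_
  rw [coeff_shift, coeff_basisVec (by omega), map_zero, if_neg (by omega)]

theorem eq_of_shift_single_eq_zero {p : ZMod n} {x : (uniserial k j l).V p} (hx : x ≠ 0)
    (h : (uniserial k j l).shift (Pi.single p x) = 0) : p = j := by
  have h' := eq_smul_of_shift_eq_zero h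
  by_contra hp
  apply hx
  have := congrFun h' p
  rw [basisVec_eq_single, Pi.smul_apply, Pi.single_eq_same, Pi.single_eq_of_ne (by simpa using hp),
    smul_zero] at this
  exact this

theorem totMap_basisVec {W : NilRep k n} (f : uniserial k j l ⟶ W) (t : ℕ) :
    totMap f (basisVec k j l t) = Pi.single (j + t) (totMap f (basisVec k j l t) (j + t)) := by
  conv_lhs => rw [basisVec_eq_single, totMap_single]
  rfl

/-- The image of the socle vector is killed by `shift`, so it lies in the socle of the target, at
the vertex `j'`. It is moreover a value of `shift ^ l`, and these vanish on a target of length at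
most `l`. -/
theorem eq_and_le_of_ne_zero {j' : ZMod n} {l' : ℕ} (f : uniserial k j (l + 1) ⟶ uniserial k j' l')
    (h : totMap f (basisVec k j (l + 1) 0) ≠ 0) : j = j' ∧ l + 1 ≤ l' := by
  have hs : (uniserial k j' l').shift (totMap f (basisVec k j (l + 1) 0)) = 0 := by
    rw [← totMap_shift, shift_basisVec_zero, map_zero]
  constructor
  · have h' := totMap_basisVec f 0
    have := eq_of_shift_single_eq_zero (fun h0 => h (by rw [h', h0, Pi.single_zero])) (h' ▸ hs)
    simpa using this
  · by_contra hl
    apply h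
    have h0 : coeff 0 (totMap f (basisVec k j (l + 1) 0)) = 0 := by
      rw [← shift_pow_basisVec (t := 0) (m := l) (by omega), totMap_shift_pow, coeff_shift_pow,
        coeff_eq_zero _ (by omega)]
    rw [eq_smul_of_shift_eq_zero hs, h0, zero_smul]

theorem not_isZero_uniserial : ¬ IsZero (uniserial k j (l + 1)) := fun h =>
  basisVec_ne_zero (Nat.succ_pos l) ((isZero_iff _).1 h (basisVec k j (l + 1) 0))

theorem isZero_uniserial_zero (k : Type u) [Field k] {n : ℕ} (j : ZMod n) :
    IsZero (uniserial k j 0) :=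
  (isZero_iff _).2 fun _ => tot_ext fun t ht => absurd ht (Nat.not_lt_zero t)

/-- Two nonzero summands would both contain the socle vector, yet they meet in zero. -/
theorem indecomposable_uniserial (k : Type u) [Field k] {n : ℕ} (j : ZMod n) (l : ℕ) :
    Indecomposable (uniserial k j (l + 1)) := by
  refine ⟨not_isZero_uniserial, fun Y Z e => ?_⟩
  by_contra! h
  have hi : Function.Injective (totMap e.inv) := totMap_injective_of_isSplitMono e.inv
  obtain ⟨hY, hZ⟩ := h
  rw [isZero_iff] at hY hZ
  push Not at hY hZ
  obtain ⟨y, hy⟩ := hY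
  obtain ⟨z, hz⟩ := hZ
  have hY' : totMap (biprod.inl ≫ e.inv) y ≠ 0 := fun h =>
    hy (totMap_injective_of_isSplitMono (biprod.inl ≫ e.inv) (h.trans (map_zero _).symm))
  have hZ' : totMap (biprod.inr ≫ e.inv) z ≠ 0 := fun h =>
    hz (totMap_injective_of_isSplitMono (biprod.inr ≫ e.inv) (h.trans (map_zero _).symm))
  obtain ⟨y', hy'⟩ := exists_totMap_eq_basisVec _ hY'
  obtain ⟨z', hz'⟩ := exists_totMap_eq_basisVec _ hZ'
  have h₁ : totMap (biprod.inl : Y ⟶ Y ⊞ Z) y' = totMap (biprod.inr : Z ⟶ Y ⊞ Z) z' :=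
    hi (hy'.trans hz'.symm)
  have h₂ := congrArg (totMap (biprod.fst : Y ⊞ Z ⟶ Y)) h₁
  rw [← totMap_comp, ← totMap_comp, biprod.inl_fst, biprod.inr_fst, totMap_zero, totMap_id] at h₂
  rw [h₂, map_zero] at hy'
  exact basisVec_ne_zero (Nat.succ_pos l) hy'.symm

/-- If the composite does not kill the socle vector, neither factor kills the socle vector of its
source; `eq_and_le_of_ne_zero` then bounds the lengths in both directions. -/
theorem eq_of_isIso_comp {j' : ZMod n} {l' : ℕ}
    (f : uniserial k j (l + 1) ⟶ uniserial k j' (l' + 1))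
    (g : uniserial k j' (l' + 1) ⟶ uniserial k j (l + 1))
    (h : totMap (f ≫ g) (basisVec k j (l + 1) 0) ≠ 0) : j = j' ∧ l = l' := by
  have hf : totMap f (basisVec k j (l + 1) 0) ≠ 0 := fun h' => h (by
    rw [totMap_comp, h', map_zero])
  have hg : totMap g (basisVec k j' (l' + 1) 0) ≠ 0 := fun h' => h (by
    rw [totMap_comp, eq_smul_of_shift_eq_zero (v := totMap f _), map_smul, h', smul_zero]
    rw [← totMap_shift, shift_basisVec_zero, map_zero])
  obtain ⟨rfl, h₁⟩ := eq_and_le_of_ne_zero f hf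
  obtain ⟨-, h₂⟩ := eq_and_le_of_ne_zero g hg
  exact ⟨rfl, by omega⟩

theorem eq_of_iso {j' : ZMod n} {l' : ℕ} (e : uniserial k j (l + 1) ≅ uniserial k j' (l' + 1)) :
    j = j' ∧ l = l' :=
  eq_of_isIso_comp e.hom e.inv (by
    rw [e.hom_inv_id]
    exact basisVec_ne_zero (Nat.succ_pos l))

/-- With `ne_zero_of_isIso`, this describes the local endomorphism ring: the non-units are exactly
the maps killing the socle. -/
theorem isIso_of_ne_zero (f : uniserial k j (l + 1) ⟶ uniserial k j (l + 1))
    (h : totMap f (basisVec k j (l + 1) 0) ≠ 0) : IsIso f :=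
  isIso_of_injective f (injective_of_ne_zero f h)

theorem ne_zero_of_isIso (f : uniserial k j (l + 1) ⟶ uniserial k j (l + 1)) [IsIso f] :
    totMap f (basisVec k j (l + 1) 0) ≠ 0 := fun h =>
  basisVec_ne_zero (Nat.succ_pos l)
    (totMap_injective_of_isSplitMono f (h.trans (map_zero _).symm))

/-- If a path of length `l` acts nontrivially through a functional and all longer ones do not,
then the representation has a uniserial direct summand. -/
theorem exists_retract {W : NilRep k n} (ξ : W.V j →ₗ[k] k)
    (hξ : ∀ v, ξ ((W.shift ^ (l + 1)) v j) = 0) (x : W.V (j + l))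
    (hx : (W.shift ^ (l + 1)) (Pi.single (j + l) x) = 0)
    (h : ξ ((W.shift ^ l) (Pi.single (j + l) x) j) ≠ 0) : IsIso (fromTop x hx ≫ toSoc ξ hξ) := by
  refine isIso_of_ne_zero _ fun h0 => h ?_
  rw [← shift_pow_basisVec (t := 0) (m := l) (by omega), totMap_shift_pow, totMap_comp,
    zero_add, totMap_fromTop] at h0
  have := congrArg (coeff 0) h0
  rwa [coeff_shift_pow, coeff_toSoc, map_zero, zero_add] at this

/-- Every indecomposable nilpotent representation of a cyclic quiver is uniserial. -/
theorem exists_iso_uniserial {X : NilRep k n} (hX : Indecomposable X) :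
    ∃ (j : ZMod n) (l : ℕ), Nonempty (X ≅ uniserial k j (l + 1)) := by
  classical
  have hn : ∃ m, ∀ v, (X.shift ^ m) v = 0 := by
    obtain ⟨m, hm⟩ := X.nilpotent
    exact ⟨m, fun v => by rw [shift, hm]; rfl⟩
  -- `l` is the maximal length of a path acting nontrivially, so both vanishing hypotheses of
  -- `exists_retract` hold automatically; a vector and a functional witness the nontrivial action.
  obtain ⟨l, hl⟩ : ∃ l, Nat.find hn = l + 1 := Nat.exists_eq_succ_of_ne_zero fun h0 => hX.1 (by
    have := Nat.find_spec hn
    rw [h0] at this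
    exact (isZero_iff X).2 this)
  have h₁ : ∀ v, (X.shift ^ (l + 1)) v = 0 := hl ▸ Nat.find_spec hn
  have h₂ := Nat.find_min hn (m := l) (by omega)
  push Not at h₂
  obtain ⟨v, hv⟩ := h₂
  obtain ⟨j, hj⟩ := Function.ne_iff.1 hv
  obtain ⟨ξ, hξ⟩ := Module.Projective.exists_dual_ne_zero k hj
  have hx := shift_pow_apply_congr X l (i := j) (v := Pi.single (j + l) (v (j + l))) (w := v)
    (by simp)
  have hξ' : ∀ v, ξ ((X.shift ^ (l + 1)) v j) = 0 := fun v => by rw [h₁]; simp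
  have := exists_retract ξ hξ' (v (j + l)) (h₁ _) (hx ▸ hξ)
  refine ⟨j, l, nonempty_iso_of_retract hX not_isZero_uniserial (fromTop (v (j + l)) (h₁ _))
    (toSoc ξ hξ' ≫ inv (fromTop (v (j + l)) (h₁ _) ≫ toSoc ξ hξ')) ?_⟩
  rw [← Category.assoc, IsIso.hom_inv_id]

end NilRep

namespace NilRep

variable {k : Type u} [Field k] {n : ℕ} {j : ZMod n} {l : ℕ}

theorem isSplitMono_of_isIso {X Y : NilRep k n} (f : X ⟶ Y) (g : Y ⟶ X) [IsIso (f ≫ g)] :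
    IsSplitMono f :=
  IsSplitMono.mk' ⟨g ≫ inv (f ≫ g), by rw [← Category.assoc, IsIso.hom_inv_id]⟩

theorem isSplitEpi_of_isIso {X Y : NilRep k n} (f : X ⟶ Y) (g : Y ⟶ X) [IsIso (f ≫ g)] :
    IsSplitEpi g :=
  IsSplitEpi.mk' ⟨inv (f ≫ g) ≫ f, by rw [Category.assoc, IsIso.inv_hom_id]⟩

/-! ### Almost split sequences -/

theorem exists_coeff_eq (j : ZMod n) (l : ℕ) (c : ℕ → k) :
    ∃ v : (uniserial k j l).Tot, ∀ t < l, coeff t v = c t := by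
  refine ⟨∑ t ∈ Finset.range l, c t • basisVec k j l t, fun s hs => ?_⟩
  rw [map_sum, Finset.sum_eq_single_of_mem s (Finset.mem_range.2 hs)]
  · rw [map_smul, coeff_basisVec hs, if_pos rfl, smul_eq_mul, mul_one]
  · intro t ht hst
    rw [map_smul, coeff_basisVec (Finset.mem_range.1 ht), if_neg hst.symm, smul_zero]

theorem totMap_incl_basisVec {t : ℕ} (ht : t < l) :
    totMap (incl k j l) (basisVec k j l t) = basisVec k j (l + 1) t :=
  tot_ext fun s _ => by rw [coeff_incl, coeff_basisVec ht, coeff_basisVec (by omega)]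

theorem totMap_quot_basisVec_zero : totMap (quot k j l) (basisVec k j (l + 1) 0) = 0 :=
  tot_ext fun s _ => by rw [coeff_quot, coeff_basisVec (by omega), map_zero, if_neg (by omega)]

theorem totMap_quot_basisVec_succ {t : ℕ} (ht : t < l) :
    totMap (quot k j l) (basisVec k j (l + 1) (t + 1)) = basisVec k (j + 1) l t :=
  tot_ext fun s _ => by
    rw [coeff_quot, coeff_basisVec (by omega), coeff_basisVec ht]
    simp

theorem totMap_quot_surjective : Function.Surjective (totMap (quot k j l)) := fun v => by
  obtain ⟨u, hu⟩ := exists_coeff_eq j (l + 1) fun t => coeff (t - 1) v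
  exact ⟨u, tot_ext fun t ht => by rw [coeff_quot, hu _ (by omega)]; rfl⟩

theorem totMap_incl_injective : Function.Injective (totMap (incl k j l)) := fun v w h =>
  tot_ext fun t _ => by rw [← coeff_incl, h, coeff_incl]

theorem exists_totMap_incl_eq {v : (uniserial k j (l + 1)).Tot} (hv : coeff l v = 0) :
    ∃ u, totMap (incl k j l) u = v := by
  obtain ⟨u, hu⟩ := exists_coeff_eq j l fun t => coeff t v
  refine ⟨u, tot_ext fun t ht => ?_⟩
  rw [coeff_incl]
  by_cases h : t < l
  · exact hu t h
  · rw [coeff_eq_zero _ (by omega), show t = l by omega, hv]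

theorem eq_smul_of_totMap_quot_eq_zero {v : (uniserial k j (l + 1)).Tot}
    (h : totMap (quot k j l) v = 0) : v = coeff 0 v • basisVec k j (l + 1) 0 := by
  refine tot_ext fun s hs => ?_
  rw [map_smul, coeff_basisVec (by omega)]
  cases s with
  | zero => simp
  | succ s => rw [← coeff_quot, h]; simp

/-- Ask whether the image of the socle vector lies in the image of `shift ^ (l + 1)`. If so, a
preimage defines a map on the longer uniserial that agrees with `h` on the socle, and the difference
factors through the socle quotient. If not, a functional separating it from that image makes `h` a
split monomorphism. -/
theorem exists_factor_left {W : NilRep k n} (h : uniserial k j (l + 1) ⟶ W)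
    (hh : ¬ IsSplitMono h) :
    ∃ (h₁ : uniserial k j (l + 1 + 1) ⟶ W) (h₂ : uniserial k (j + 1) l ⟶ W),
      h = incl k j (l + 1) ≫ h₁ + quot k j l ≫ h₂ := by
  set x := totMap h (basisVec k j (l + 1) l) (j + l) with hx
  have hE : totMap h (basisVec k j (l + 1) l) = Pi.single (j + l) x := totMap_basisVec h l
  have hx0 : (W.shift ^ (l + 1)) (Pi.single (j + l) x) = 0 := by
    rw [← hE, ← totMap_shift_pow, shift_pow_uniserial, map_zero]
  have hE0 : totMap h (basisVec k j (l + 1) 0) = (W.shift ^ l) (Pi.single (j + l) x) := by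
    rw [← shift_pow_basisVec (t := 0) (m := l) (by omega), totMap_shift_pow, zero_add, hE]
  have hft : fromTop x hx0 = h := hom_ext_top (by rw [totMap_fromTop, hE])
  let A : W.Tot →ₗ[k] W.V j := LinearMap.proj j ∘ₗ (W.shift ^ (l + 1))
  by_cases hy : (W.shift ^ l) (Pi.single (j + l) x) j ∈ LinearMap.range A
  · obtain ⟨v, hv⟩ := hy
    have h1 : (W.shift ^ (l + 1)) (Pi.single (j + (l + 1 : ℕ)) (v (j + (l + 1 : ℕ)))) =
        (W.shift ^ l) (Pi.single (j + l) x) := by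
      funext i
      by_cases hi : i = j
      · subst hi
        rw [← hv, shift_pow_apply_congr (w := v)]
        · rfl
        · simp
      · rw [shift_pow_single_of_ne, shift_pow_single_of_ne]
        · exact fun h => hi (add_right_cancel h)
        · exact fun h => hi (add_right_cancel h)
    have h2 : (W.shift ^ (l + 1 + 1)) (Pi.single (j + (l + 1 : ℕ)) (v (j + (l + 1 : ℕ)))) = 0 := by
      rw [pow_succ', Module.End.mul_apply, h1, ← Module.End.mul_apply, ← pow_succ', hx0]
    obtain ⟨h₂, hh₂⟩ := exists_desc_of_surjective (quot k j l) totMap_quot_surjective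
      (h - incl k j (l + 1) ≫ fromTop _ h2) fun v hv => by
        rw [eq_smul_of_totMap_quot_eq_zero hv, map_smul, totMap_sub, totMap_comp,
          totMap_incl_basisVec (by omega), hE0, ← h1,
          ← shift_pow_basisVec (t := 0) (m := l + 1) (by omega), totMap_shift_pow, zero_add,
          totMap_fromTop, sub_self, smul_zero]
    exact ⟨fromTop _ h2, h₂, by rw [hh₂, add_sub_cancel]⟩
  · exfalso
    obtain ⟨ξ, hξ, hξ'⟩ := Submodule.exists_le_ker_of_notMem hy
    have hξ'' : ∀ v, ξ ((W.shift ^ (l + 1)) v j) = 0 := fun v => hξ' ⟨v, rfl⟩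
    have := exists_retract ξ hξ'' x hx0 hξ
    rw [hft] at this
    exact hh (isSplitMono_of_isIso h (toSoc ξ hξ''))

/-- Dual to `exists_factor_left`: the question is whether the top coefficient `θ` of `h` factors
through the paths `A` of length `l + 1` ending at `j`. If so, `toSoc` lifts `h` up to a map into the
radical; if not, a vector in the kernel of `A` with nonzero top coefficient splits `h`. -/
theorem exists_factor_right {W : NilRep k n} (h : W ⟶ uniserial k (j + 1) (l + 1))
    (hh : ¬ IsSplitEpi h) :
    ∃ (h₁ : W ⟶ uniserial k j (l + 1 + 1)) (h₂ : W ⟶ uniserial k (j + 1) l),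
      h = h₁ ≫ quot k j (l + 1) + h₂ ≫ incl k (j + 1) l := by
  let A : W.Tot →ₗ[k] W.V j := LinearMap.proj j ∘ₗ (W.shift ^ (l + 1))
  let θ : W.Tot →ₗ[k] k := coeff l ∘ₗ totMap h
  by_cases hθ : θ ∈ (LinearMap.ker A).dualAnnihilator
  -- A functional vanishing on the kernel of `A` has the form `η ∘ A`.
  · rw [← LinearMap.range_dualMap_eq_dualAnnihilator_ker] at hθ
    obtain ⟨η, hη⟩ := hθ
    have hη' : ∀ v, η ((W.shift ^ (l + 1)) v j) = coeff l (totMap h v) :=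
      fun v => LinearMap.congr_fun hη v
    have h0 : ∀ v, η ((W.shift ^ (l + 1 + 1)) v j) = 0 := fun v => by
      rw [pow_succ, Module.End.mul_apply, hη', totMap_shift, coeff_shift, coeff_eq_zero _ le_rfl]
    obtain ⟨h₂, hh₂⟩ := exists_lift_of_injective (incl k (j + 1) l) totMap_incl_injective
      (h - toSoc η h0 ≫ quot k j (l + 1)) fun v => exists_totMap_incl_eq (by
        rw [totMap_sub, map_sub, totMap_comp, coeff_quot, coeff_toSoc, hη', sub_self])
    exact ⟨toSoc η h0, h₂, by rw [hh₂, add_sub_cancel]⟩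
  · exfalso
    rw [Submodule.mem_dualAnnihilator] at hθ
    push Not at hθ
    obtain ⟨v, hv, hv'⟩ := hθ
    set x := v (j + 1 + l) with hx
    let ξ : W.V (j + 1) →ₗ[k] k := coeff 0 ∘ₗ totMap h ∘ₗ LinearMap.single k W.V (j + 1)
    have hξ : ∀ (m : ℕ) (v : W.Tot), ξ ((W.shift ^ m) v (j + 1)) = coeff m (totMap h v) := by
      intro m v
      rw [← zero_add m, ← coeff_shift_pow, ← totMap_shift_pow, zero_add]
      simp only [ξ, LinearMap.comp_apply, LinearMap.single_apply, totMap_single]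
      exact coeff_zero_congr (by rw [Pi.single_eq_same, totMap_apply])
    have hξ0 : ∀ v, ξ ((W.shift ^ (l + 1)) v (j + 1)) = 0 := fun v => by
      rw [hξ, coeff_eq_zero _ le_rfl]
    have hts : toSoc ξ hξ0 = h := hom_ext_soc fun v => by rw [coeff_toSoc, hξ]
    have hx0 : (W.shift ^ (l + 1)) (Pi.single (j + 1 + l) x) = 0 := by
      funext i
      -- A path of length `l + 1` starting at `j + 1 + l` ends at `j`, so only this component could
      -- survive, and there `v` is killed by `A`.
      by_cases hi : i = j
      · subst hi
        have hA : (W.shift ^ (l + 1)) v i = 0 := hv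
        refine Eq.trans (shift_pow_apply_congr W (l + 1) ?_) hA
        · have : ∀ p, p = i + 1 + (l : ZMod n) →
              (Pi.single (i + 1 + l) (v (i + 1 + l)) : W.Tot) p = v p := by
            rintro _ rfl
            simp
          exact this _ (by push_cast; ring)
      · rw [shift_pow_single_of_ne]
        · rfl
        · intro h
          apply hi
          push_cast at h
          linear_combination h
    have hne : ξ ((W.shift ^ l) (Pi.single (j + 1 + l) x) (j + 1)) ≠ 0 := by
      rw [shift_pow_apply_congr (w := v) W l (by simp [hx]), hξ]
      exact hv'
    have := exists_retract ξ hξ0 x hx0 hne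
    rw [hts] at this
    exact hh (isSplitEpi_of_isIso (fromTop x hx0) h)

/-- The left map of the standard almost split sequence. -/
def asLeft (k : Type u) [Field k] {n : ℕ} (j : ZMod n) (l : ℕ) :
    uniserial k j (l + 1) ⟶ uniserial k j (l + 1 + 1) ⊞ uniserial k (j + 1) l :=
  biprod.lift (incl k j (l + 1)) (quot k j l)

/-- The right map of the standard almost split sequence. -/
def asRight (k : Type u) [Field k] {n : ℕ} (j : ZMod n) (l : ℕ) :
    uniserial k j (l + 1 + 1) ⊞ uniserial k (j + 1) l ⟶ uniserial k (j + 1) (l + 1) :=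
  biprod.desc (quot k j (l + 1)) (-incl k (j + 1) l)

theorem totMap_biprod_ext {X Y : NilRep k n} {v w : (X ⊞ Y).Tot}
    (h₁ : totMap (biprod.fst : X ⊞ Y ⟶ X) v = totMap (biprod.fst : X ⊞ Y ⟶ X) w)
    (h₂ : totMap (biprod.snd : X ⊞ Y ⟶ Y) v = totMap (biprod.snd : X ⊞ Y ⟶ Y) w) : v = w := by
  rw [← totMap_id _ v, ← totMap_id _ w, ← biprod.total, totMap_add, totMap_add, totMap_comp,
    totMap_comp, totMap_comp, totMap_comp, h₁, h₂]

theorem isShortExact_as (j : ZMod n) (l : ℕ) : IsShortExact (asLeft k j l) (asRight k j l) := by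
  have hr : ∀ v, totMap (asRight k j l) v = totMap (quot k j (l + 1)) (totMap biprod.fst v) -
      totMap (incl k (j + 1) l) (totMap biprod.snd v) := fun v => by
    rw [asRight, biprod.desc_eq, totMap_add, totMap_comp, totMap_comp, totMap_neg, sub_eq_add_neg]
  have h₁ : ∀ v, totMap biprod.fst (totMap (asLeft k j l) v) = totMap (incl k j (l + 1)) v :=
    fun v => by rw [← totMap_comp, asLeft, biprod.lift_fst]
  have h₂ : ∀ v, totMap biprod.snd (totMap (asLeft k j l) v) = totMap (quot k j l) v :=
    fun v => by rw [← totMap_comp, asLeft, biprod.lift_snd]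
  refine isShortExact_iff.2 ⟨fun v w h => ?_, fun v => ?_, fun v => ⟨fun hv => ?_, ?_⟩⟩
  · apply totMap_incl_injective
    rw [← h₁, h, h₁]
  · obtain ⟨u, hu⟩ := totMap_quot_surjective v
    refine ⟨totMap biprod.inl u, ?_⟩
    rw [← totMap_comp, asRight, biprod.inl_desc, hu]
  · rw [hr, sub_eq_zero] at hv
    have hc : ∀ t, coeff (t + 1) (totMap biprod.fst v) = coeff t (totMap biprod.snd v) := by
      intro t
      rw [← coeff_quot, hv, coeff_incl]
    -- For `t = l` the relation `hc` makes the top coefficient of the first component vanish,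
    -- because the second component has length `l`.
    obtain ⟨u, hu⟩ := exists_totMap_incl_eq (v := totMap biprod.fst v)
      (by rw [hc, coeff_eq_zero _ le_rfl])
    refine ⟨u, totMap_biprod_ext (by rw [h₁, hu]) (tot_ext fun t _ => ?_)⟩
    rw [h₂, coeff_quot, ← hc, ← hu, coeff_incl]
  · rintro ⟨u, rfl⟩
    rw [hr, h₁, h₂, sub_eq_zero]
    exact tot_ext fun t _ => by rw [coeff_quot, coeff_incl, coeff_incl, coeff_quot]

theorem isAlmostSplit_as (j : ZMod n) (l : ℕ) : IsAlmostSplit (asLeft k j l) (asRight k j l) where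
  shortExact := isShortExact_as j l
  indecomposable_left := indecomposable_uniserial k j l
  indecomposable_right := indecomposable_uniserial k (j + 1) l
  not_splitMono h := by
    have h' : biprod.lift (incl k j (l + 1)) (quot k j l) ≫ retraction (asLeft k j l) = 𝟙 _ :=
      IsSplitMono.id (asLeft k j l)
    rw [biprod.lift_eq, Preadditive.add_comp, Category.assoc, Category.assoc] at h'
    have := congrArg (fun f => totMap f (basisVec k j (l + 1) 0)) h'
    simp only [totMap_add, totMap_comp, totMap_quot_basisVec_zero, map_zero, add_zero, totMap_id]
      at this
    rw [totMap_incl_basisVec (by omega), ← totMap_comp] at this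
    -- The quotient kills the socle, so a retraction would give a map from length `l + 2` to length
    -- `l + 1` that is nonzero on the socle.
    have := eq_and_le_of_ne_zero _ (this.trans_ne (basisVec_ne_zero (Nat.succ_pos l)))
    omega
  left_almost_split W h hh := by
    obtain ⟨h₁, h₂, rfl⟩ := exists_factor_left h hh
    exact ⟨biprod.desc h₁ h₂, by rw [asLeft, biprod.lift_desc]⟩
  not_splitEpi h := by
    obtain ⟨s, h'⟩ : ∃ s, s ≫ biprod.desc (quot k j (l + 1)) (-incl k (j + 1) l) = 𝟙 _ :=
      ⟨_, IsSplitEpi.id (asRight k j l)⟩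
    rw [biprod.desc_eq, Preadditive.comp_add, ← Category.assoc, ← Category.assoc] at h'
    have := congrArg (fun f => coeff 0 (totMap f (basisVec k (j + 1) (l + 1) 0))) h'
    simp only [totMap_add, totMap_id, map_add] at this
    rw [totMap_comp, coeff_quot, ← coeff_shift, ← totMap_shift, shift_basisVec_zero, map_zero,
      map_zero, zero_add, totMap_comp, coeff_basisVec (by omega), if_pos rfl] at this
    -- The first component contributes nothing to the zeroth coefficient, and the second is a map
    -- from length `l + 1` to length `l`, which kills the socle.
    have h0 : totMap (s ≫ biprod.snd) (basisVec k (j + 1) (l + 1) 0) = 0 := by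
      by_contra h0
      have := eq_and_le_of_ne_zero _ h0
      omega
    rw [h0, map_zero, map_zero] at this
    exact zero_ne_one this
  right_almost_split W h hh := by
    obtain ⟨h₁, h₂, rfl⟩ := exists_factor_right h hh
    exact ⟨biprod.lift h₁ (-h₂), by rw [asRight, biprod.lift_desc]; simp⟩

/-- An almost split sequence which starts in a uniserial representation is isomorphic to the
standard one. -/
theorem IsAlmostSplit.nonempty_iso {X E Z : NilRep k n} {f : X ⟶ E} {g : E ⟶ Z}
    (h : IsAlmostSplit f g) (e : X ≅ uniserial k j (l + 1)) :
    Nonempty (Z ≅ uniserial k (j + 1) (l + 1)) := by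
  have hs := isAlmostSplit_as (k := k) j l
  -- Left almost splitness of each sequence gives comparison maps `a` and `b` of middle terms, which
  -- induce `α` and `β` on the right-hand terms.
  obtain ⟨a, ha⟩ := h.left_almost_split _ (e.hom ≫ asLeft k j l) fun hm => hs.not_splitMono (by
    have : asLeft k j l = e.inv ≫ e.hom ≫ asLeft k j l := by simp
    rw [this]
    infer_instance)
  obtain ⟨b, hb⟩ := hs.left_almost_split _ (e.inv ≫ f) fun hm => h.not_splitMono (by
    have : f = e.hom ≫ e.inv ≫ f := by simp
    rw [this]
    infer_instance)
  obtain ⟨α, hα⟩ := h.shortExact.exists_desc (a ≫ asRight k j l) (by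
    rw [← Category.assoc, ha, Category.assoc, hs.shortExact.comp_eq_zero, Limits.comp_zero])
  obtain ⟨β, hβ⟩ := hs.shortExact.exists_desc (b ≫ g) (by
    rw [← Category.assoc, hb, Category.assoc, h.shortExact.comp_eq_zero, Limits.comp_zero])
  have hfab : f ≫ a ≫ b = f := by
    rw [← Category.assoc, ha, Category.assoc, hb]
    simp
  have hgab : (a ≫ b) ≫ g = g ≫ α ≫ β := by
    rw [← Category.assoc, hα, Category.assoc, Category.assoc, hβ]
  -- Otherwise `α ≫ β` lifts along `g` to some `ψ`; then `a ≫ b - g ≫ ψ` factors through `f`, and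
  -- the factor `σ` is a retraction of `f`.
  have hsplit : IsSplitEpi (α ≫ β) := by
    by_contra hne
    obtain ⟨ψ, hψ⟩ := h.right_almost_split _ _ hne
    obtain ⟨σ, hσ⟩ := h.shortExact.exists_lift (a ≫ b - g ≫ ψ) (by
      rw [Preadditive.sub_comp, hgab, Category.assoc, hψ, sub_self])
    have h1 : f ≫ σ ≫ f = f := by
      rw [hσ, Preadditive.comp_sub, hfab, ← Category.assoc, h.shortExact.comp_eq_zero, zero_comp,
        sub_zero]
    refine h.not_splitMono (IsSplitMono.mk' ⟨σ, hom_ext_totMap fun v => ?_⟩)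
    apply (isShortExact_iff.1 h.shortExact).1
    rw [← totMap_comp, Category.assoc, h1, totMap_id]
  have hiso : IsIso (α ≫ β) := isIso_of_surjective _ (totMap_surjective_of_isSplitEpi _)
  obtain ⟨p, m, ⟨e'⟩⟩ := exists_iso_uniserial h.indecomposable_right
  have h2 : IsIso ((e'.inv ≫ α) ≫ β ≫ e'.hom) := by
    have : (e'.inv ≫ α) ≫ β ≫ e'.hom = e'.inv ≫ (α ≫ β) ≫ e'.hom := by simp
    rw [this]
    infer_instance
  obtain ⟨rfl, rfl⟩ := eq_of_isIso_comp _ _ (ne_zero_of_isIso ((e'.inv ≫ α) ≫ β ≫ e'.hom))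
  exact ⟨e'⟩

end NilRep

namespace NilRep

variable {k : Type u} [Field k] {n : ℕ} {j j' : ZMod n} {l l' : ℕ}

/-! ### Irreducible morphisms between uniserial representations -/

theorem not_isSplitMono_of_mem_rad {X Y : NilRep k n} (hX : ¬ IsZero X) {f : X ⟶ Y}
    (hf : f ∈ rad X Y) : ¬ IsSplitMono f := fun _ => hX <| by
  have h := hf (retraction f)
  rw [IsSplitMono.id, sub_self] at h
  rw [IsZero.iff_id_eq_zero, ← IsIso.hom_inv_id (0 : X ⟶ X), zero_comp]

theorem mem_rad_of_comp_eq_zero {W : NilRep k n} (f : uniserial k j (l + 1) ⟶ W)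
    (hf : ∀ g : W ⟶ uniserial k j (l + 1), totMap (f ≫ g) (basisVec k j (l + 1) 0) = 0) :
    f ∈ rad _ W := fun g => by
  refine isIso_of_ne_zero _ ?_
  rw [totMap_sub, hf, totMap_id, sub_zero]
  exact basisVec_ne_zero (Nat.succ_pos l)

theorem mem_rad_of_ne (f : uniserial k j (l + 1) ⟶ uniserial k j' (l' + 1))
    (h : ¬ (j = j' ∧ l = l')) : f ∈ rad _ _ :=
  mem_rad_of_comp_eq_zero f fun g => by
    by_contra h'
    exact h (eq_of_isIso_comp f g h')

theorem mem_rad_of_totMap_eq_zero {W : NilRep k n} (f : uniserial k j (l + 1) ⟶ W)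
    (h : totMap f (basisVec k j (l + 1) 0) = 0) : f ∈ rad _ _ :=
  mem_rad_of_comp_eq_zero f fun g => by rw [totMap_comp, h, map_zero]

/-- If `h ≫ f` were nonzero on the socle it would be invertible, and `h` would be annihilated by the
isomorphism `1 - f (h f)⁻¹ h`, written in composition order, hence zero. -/
theorem totMap_comp_eq_zero_of_mem_rad {W : NilRep k n} (h : uniserial k j (l + 1) ⟶ W)
    {f : W ⟶ uniserial k j (l + 1)} (hf : f ∈ rad _ _) :
    totMap (h ≫ f) (basisVec k j (l + 1) 0) = 0 := by
  by_contra hne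
  have h₁ := isIso_of_ne_zero _ hne
  have h₂ := hf (inv (h ≫ f) ≫ h)
  have h₃ : h ≫ (𝟙 W - f ≫ inv (h ≫ f) ≫ h) = 0 := by
    rw [Preadditive.comp_sub, ← Category.assoc, ← Category.assoc, IsIso.hom_inv_id]
    simp
  have h₄ : h = 0 := by
    rw [← cancel_mono (𝟙 W - f ≫ inv (h ≫ f) ≫ h), h₃, zero_comp]
  rw [h₄, zero_comp] at hne
  exact hne rfl

/-- The endomorphism scales the socle line; subtracting that scalar leaves a map killing the socle.
-/
theorem exists_sub_smul_id_mem_rad (f : uniserial k j (l + 1) ⟶ uniserial k j (l + 1)) :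
    ∃ c : k, f - c • 𝟙 _ ∈ rad _ _ := by
  refine ⟨coeff 0 (totMap f (basisVec k j (l + 1) 0)), mem_rad_of_totMap_eq_zero _ ?_⟩
  rw [totMap_sub, totMap_smul, totMap_id, sub_eq_zero]
  apply eq_smul_of_shift_eq_zero
  rw [← totMap_shift, shift_basisVec_zero, map_zero]

theorem incl_mem_rad : incl k j (l + 1) ∈ rad _ _ :=
  mem_rad_of_ne _ fun h => by omega

theorem quot_mem_rad : quot k j l ∈ rad _ _ :=
  mem_rad_of_totMap_eq_zero _ totMap_quot_basisVec_zero

theorem comp_mem_radSq {X Y Z : NilRep k n} {f : X ⟶ Y} {g : Y ⟶ Z} (hf : f ∈ rad X Y)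
    (hg : g ∈ rad Y Z) : f ≫ g ∈ radSq X Z :=
  Submodule.subset_span ⟨Y, f, g, hf, hg, rfl⟩

theorem quot_comp_mem_radSq (h : uniserial k (j + 1) l ⟶ uniserial k j' (l' + 1))
    (hne : ¬ (j + 1 = j' ∧ l = l' + 1)) : quot k j l ≫ h ∈ radSq _ _ := by
  cases l with
  | zero =>
    -- A simple object modulo its socle is zero, so this component is absent.
    rw [(isZero_uniserial_zero k (j + 1)).eq_of_src h 0, Limits.comp_zero]
    exact zero_mem _
  | succ l => exact comp_mem_radSq quot_mem_rad (mem_rad_of_ne h (by simpa using hne))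

theorem irrDim_eq_zero {X Y : NilRep k n} (h : rad X Y ≤ radSq X Y) : irrDim X Y = 0 := by
  rw [irrDim, Submodule.submoduleOf_eq_top.2 h]
  have : Subsingleton (↥(rad X Y) ⧸ (⊤ : Submodule k (rad X Y))) :=
    Submodule.Quotient.subsingleton_iff.2 rfl
  exact Module.finrank_zero_of_subsingleton

theorem irrDim_eq_one {X Y : NilRep k n} {f : X ⟶ Y} (hf : f ∈ rad X Y) (hf' : f ∉ radSq X Y)
    (h : ∀ g ∈ rad X Y, ∃ c : k, g - c • f ∈ radSq X Y) : irrDim X Y = 1 := by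
  refine finrank_eq_one (Submodule.Quotient.mk ⟨f, hf⟩) (fun h0 => hf' ?_) fun w => ?_
  · exact (Submodule.Quotient.mk_eq_zero ((radSq X Y).submoduleOf (rad X Y))).1 h0
  · obtain ⟨⟨g, hg⟩, rfl⟩ := Submodule.Quotient.mk_surjective _ w
    obtain ⟨c, hc⟩ := h g hg
    refine ⟨c, ?_⟩
    rw [← Submodule.Quotient.mk_smul, eq_comm, Submodule.Quotient.eq]
    exact hc

theorem exists_factor_of_mem_rad {W : NilRep k n} {g : uniserial k j (l + 1) ⟶ W}
    (hg : g ∈ rad _ _) : ∃ (h₁ : uniserial k j (l + 1 + 1) ⟶ W) (h₂ : uniserial k (j + 1) l ⟶ W),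
      g = incl k j (l + 1) ≫ h₁ + quot k j l ≫ h₂ :=
  exists_factor_left g (not_isSplitMono_of_mem_rad not_isZero_uniserial hg)

/-- Evaluation at the socle vector kills `radSq` but not the inclusion. Factoring the first radical
map, its quotient part kills the socle, and its other part leads to a radical endomorphism of the
target. -/
theorem incl_notMem_radSq : incl k j (l + 1) ∉ radSq _ _ := fun hmem => by
  have key : radSq (uniserial k j (l + 1)) (uniserial k j (l + 1 + 1)) ≤
      { carrier := {h | totMap h (basisVec k j (l + 1) 0) = 0}
        add_mem' := fun {a b} ha hb => by
          rw [Set.mem_ofPred_eq] at *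
          rw [totMap_add, ha, hb, add_zero]
        zero_mem' := rfl
        smul_mem' := fun c x hx => by
          rw [Set.mem_ofPred_eq] at *
          rw [totMap_smul, hx, smul_zero] } := by
    refine Submodule.span_le.2 ?_
    rintro _ ⟨Z, f, g, hf, hg, rfl⟩
    obtain ⟨h₁, h₂, rfl⟩ := exists_factor_of_mem_rad hf
    change totMap _ _ = 0
    have := totMap_comp_eq_zero_of_mem_rad h₁ hg
    rw [totMap_comp] at this
    rw [totMap_comp, totMap_add, totMap_comp, totMap_comp, totMap_quot_basisVec_zero,
      totMap_incl_basisVec (by omega), map_zero, add_zero, this]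
  have h0 : totMap (incl k j (l + 1)) (basisVec k j (l + 1) 0) = 0 := key hmem
  rw [totMap_incl_basisVec (by omega)] at h0
  exact basisVec_ne_zero (by omega) h0

/-- Here the separating functional is the top coefficient of the image of the generator. A radical
endomorphism of the target cannot reach it, and neither can a map through the inclusion, where the
generator becomes a value of `shift`. -/
theorem quot_notMem_radSq : quot k j (l + 1) ∉ radSq _ _ := fun hmem => by
  have key : radSq (uniserial k j (l + 1 + 1)) (uniserial k (j + 1) (l + 1)) ≤
      { carrier := {h | coeff l (totMap h (basisVec k j (l + 1 + 1) (l + 1))) = 0}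
        add_mem' := fun {a b} ha hb => by
          rw [Set.mem_ofPred_eq] at *
          rw [totMap_add, map_add, ha, hb, add_zero]
        zero_mem' := by
          rw [Set.mem_ofPred_eq, totMap_zero, map_zero]
        smul_mem' := fun c x hx => by
          rw [Set.mem_ofPred_eq] at *
          rw [totMap_smul, map_smul, hx, smul_zero] } := by
    refine Submodule.span_le.2 ?_
    rintro _ ⟨Z, f, g, hf, hg, rfl⟩
    obtain ⟨h₁, h₂, rfl⟩ := exists_factor_of_mem_rad hf
    change coeff l (totMap _ _) = 0
    have h := totMap_comp_eq_zero_of_mem_rad h₂ hg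
    rw [← shift_pow_basisVec (t := 0) (m := l) (by omega), totMap_shift_pow, zero_add] at h
    have h' := congrArg (coeff 0) h
    rw [coeff_shift_pow, map_zero, zero_add, totMap_comp] at h'
    rw [totMap_comp, totMap_add, totMap_comp, totMap_comp, map_add, map_add,
      totMap_quot_basisVec_succ (by omega), h', totMap_incl_basisVec (by omega),
      ← shift_pow_basisVec (t := l + 1) (m := 1) (by omega), pow_one, totMap_shift, totMap_shift,
      coeff_shift, coeff_eq_zero _ le_rfl, add_zero]
  have h0 : coeff l (totMap (quot k j (l + 1)) (basisVec k j (l + 1 + 1) (l + 1))) = 0 := key hmem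
  rw [totMap_quot_basisVec_succ (by omega), coeff_basisVec (by omega), if_pos rfl] at h0
  exact one_ne_zero h0

open Classical in
/-- The dimension of the space of irreducible morphisms between uniserial representations. -/
theorem irrDim_uniserial (j j' : ZMod n) (l l' : ℕ) :
    irrDim (uniserial k j (l + 1)) (uniserial k j' (l' + 1)) =
      if (j' = j ∧ l' = l + 1) ∨ (j' = j + 1 ∧ l = l' + 1) then 1 else 0 := by
  split_ifs with h
  · rcases h with ⟨rfl, rfl⟩ | ⟨rfl, rfl⟩
    · refine irrDim_eq_one incl_mem_rad incl_notMem_radSq fun g hg => ?_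
      obtain ⟨h₁, h₂, rfl⟩ := exists_factor_of_mem_rad hg
      -- `h₁` is an endomorphism, so a scalar modulo the radical; the other summand joins objects of
      -- different lengths and lies in `radSq`.
      obtain ⟨c, hc⟩ := exists_sub_smul_id_mem_rad h₁
      refine ⟨c, ?_⟩
      have : incl k j' (l + 1) ≫ h₁ + quot k j' l ≫ h₂ - c • incl k j' (l + 1) =
          incl k j' (l + 1) ≫ (h₁ - c • 𝟙 _) + quot k j' l ≫ h₂ := by
        rw [Preadditive.comp_sub, Linear.comp_smul, Category.comp_id]
        abel
      rw [this]
      exact add_mem (comp_mem_radSq incl_mem_rad hc) (quot_comp_mem_radSq _ (by omega))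
    · refine irrDim_eq_one quot_mem_rad quot_notMem_radSq fun g hg => ?_
      obtain ⟨h₁, h₂, rfl⟩ := exists_factor_of_mem_rad hg
      obtain ⟨c, hc⟩ := exists_sub_smul_id_mem_rad h₂
      refine ⟨c, ?_⟩
      have : incl k j (l' + 1 + 1) ≫ h₁ + quot k j (l' + 1) ≫ h₂ - c • quot k j (l' + 1) =
          incl k j (l' + 1 + 1) ≫ h₁ + quot k j (l' + 1) ≫ (h₂ - c • 𝟙 _) := by
        rw [Preadditive.comp_sub, Linear.comp_smul, Category.comp_id]
        abel
      rw [this]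
      exact add_mem (comp_mem_radSq incl_mem_rad (mem_rad_of_ne _ (by omega)))
        (comp_mem_radSq quot_mem_rad hc)
  · refine irrDim_eq_zero fun g hg => ?_
    obtain ⟨h₁, h₂, rfl⟩ := exists_factor_of_mem_rad hg
    refine add_mem (comp_mem_radSq incl_mem_rad (mem_rad_of_ne _ fun h' => h (.inl ?_)))
      (quot_comp_mem_radSq _ fun h' => h (.inr ?_))
    · exact ⟨h'.1.symm, h'.2.symm⟩
    · exact ⟨h'.1.symm, h'.2⟩

/-! ### Composition series -/

theorem IsShortExact.finrank_tot [NeZero n] {X Y Z : NilRep k n} {f : X ⟶ Y} {g : Y ⟶ Z}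
    (h : IsShortExact f g) :
    Module.finrank k Y.Tot = Module.finrank k X.Tot + Module.finrank k Z.Tot := by
  obtain ⟨h₁, h₂, h₃⟩ := isShortExact_iff.1 h
  have hk : LinearMap.ker (totMap g) = LinearMap.range (totMap f) := by
    ext v
    exact h₃ v
  rw [← LinearMap.finrank_range_add_finrank_ker (totMap g), hk, LinearMap.range_eq_top.2 h₂,
    finrank_top, LinearMap.finrank_range_of_inj h₁, add_comm]

theorem finrank_tot_simple [NeZero n] (j : ZMod n) : Module.finrank k (simple k j).Tot = 1 := by
  have h : ∀ i, Module.finrank k ((simple k j).V i) = if i = j then 1 else 0 := by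
    intro i
    have h' : ∀ S : Submodule k k, S = (if i = j then ⊤ else ⊥) →
        Module.finrank k S = if i = j then 1 else 0 := by
      rintro S rfl
      by_cases h : i = j
      · rw [if_pos h, if_pos h, finrank_top, Module.finrank_self]
      · rw [if_neg h, if_neg h, finrank_bot]
    exact h' _ rfl
  rw [Module.finrank_pi_fintype]
  simp [h]

theorem finrank_tot_of_isZero {X : NilRep k n} (h : IsZero X) : Module.finrank k X.Tot = 0 := by
  have : Subsingleton X.Tot := ⟨fun v w => by
    rw [(isZero_iff X).1 h v, (isZero_iff X).1 h w]⟩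
  exact Module.finrank_zero_of_subsingleton

theorem finrank_tot_of_iso {X Y : NilRep k n} (e : X ≅ Y) :
    Module.finrank k X.Tot = Module.finrank k Y.Tot :=
  (LinearEquiv.ofBijective (totMap e.hom) ⟨totMap_injective_of_isSplitMono _,
    totMap_surjective_of_isSplitEpi _⟩).finrank_eq

theorem HasCompositionSeries.finrank_tot [NeZero n] {M : NilRep k n} {m : ℕ} {s : Fin m → ZMod n}
    (h : HasCompositionSeries M m s) : Module.finrank k M.Tot = m := by
  obtain ⟨F, h₀, ⟨e⟩, hF⟩ := h
  have key : ∀ t ≤ m, Module.finrank k (F t).Tot = t := by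
    intro t ht
    induction t with
    | zero => exact finrank_tot_of_isZero h₀
    | succ t ih =>
      obtain ⟨f, g, hfg⟩ := hF ⟨t, ht⟩
      rw [hfg.finrank_tot, finrank_tot_simple, ih (by omega)]
  rw [← finrank_tot_of_iso e, key m le_rfl]

theorem hasCompositionSeries_of_iso {M M' : NilRep k n} (e : M ≅ M') {m : ℕ} {s : Fin m → ZMod n}
    (h : HasCompositionSeries M m s) : HasCompositionSeries M' m s := by
  obtain ⟨F, h₀, ⟨e'⟩, hF⟩ := h
  exact ⟨F, h₀, ⟨e' ≪≫ e⟩, hF⟩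

/-- The quotient of a uniserial representation by its radical. -/
def top (k : Type u) [Field k] {n : ℕ} (j : ZMod n) (l : ℕ) :
    uniserial k j (l + 1) ⟶ simple k (j + l) :=
  ⟨fun i => LinearMap.codRestrict (if i = j + l then ⊤ else ⊥ : Submodule k k)
    (LinearMap.proj l ∘ₗ uval i) fun v => by
      split_ifs with h
      · trivial
      · exact uval_eq_zero _ fun h' => h h'.2.symm, fun i =>
    LinearMap.ext fun v => Subtype.ext (uval_eq_zero v (t := l + 1) fun h => by omega)⟩

theorem totMap_top_apply (v : (uniserial k j (l + 1)).Tot) (i : ZMod n) :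
    (show k from (show ↥(if i = j + l then ⊤ else ⊥ : Submodule k k) from
      totMap (top k j l) v i).1) = uval i (v i) l := rfl

theorem isShortExact_top (j : ZMod n) (l : ℕ) : IsShortExact (incl k j l) (top k j l) := by
  refine isShortExact_iff.2 ⟨totMap_incl_injective, fun v => ?_, fun v => ⟨fun hv => ?_, ?_⟩⟩
  · let c : k := (show ↥(if j + l = j + l then ⊤ else ⊥ : Submodule k k) from v (j + l)).1
    refine ⟨c • basisVec k j (l + 1) l, funext fun i => Subtype.ext ?_⟩
    refine (totMap_top_apply _ i).trans ?_
    by_cases h : j + l = i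
    · rw [uval_apply_of_eq _ h, map_smul, coeff_basisVec (by omega), if_pos rfl, smul_eq_mul,
        mul_one]
      subst h
      rfl
    · rw [uval_eq_zero _ fun h' => h h'.2]
      have : ∀ x : ↥(if i = j + l then ⊤ else ⊥ : Submodule k k), x.1 = 0 := by
        rw [if_neg (Ne.symm h)]
        exact fun x => x.2
      exact (this _).symm
  · apply exists_totMap_incl_eq
    have := congrArg Subtype.val (congrFun hv (j + l))
    exact this
  · rintro ⟨u, rfl⟩
    funext i
    exact Subtype.ext (uval_eq_zero (u i) fun h => by omega)

theorem hasCompositionSeries_uniserial (k : Type u) [Field k] {n : ℕ} (j : ZMod n) (m : ℕ) :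
    HasCompositionSeries (uniserial k j m) m fun t => j + (t : ℕ) :=
  ⟨fun t => uniserial k j t, isZero_uniserial_zero k j, ⟨Iso.refl _⟩,
    fun t => ⟨incl k j t, top k j t, isShortExact_top j t⟩⟩

/-- The length is the total dimension. The first step of the series is a simple subobject at `s 0`,
whose image is killed by `shift` and must therefore sit at the socle vertex. -/
theorem HasCompositionSeries.eq_of_uniserial [NeZero n] {m : ℕ} {s : Fin (m + 1) → ZMod n}
    (h : HasCompositionSeries (uniserial k j (l + 1)) (m + 1) s) : j = s 0 ∧ l = m := by
  refine ⟨?_, ?_⟩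
  · obtain ⟨F, h₀, ⟨e⟩, hF⟩ := h
    have key : ∀ t ≤ m, ∃ f : F 1 ⟶ F (t + 1), Function.Injective (totMap f) := by
      intro t ht
      induction t with
      | zero => exact ⟨𝟙 _, fun v w h => h⟩
      | succ t ih =>
        obtain ⟨f, hf⟩ := ih (by omega)
        obtain ⟨f', g', hfg⟩ := hF ⟨t + 1, by omega⟩
        exact ⟨f ≫ f', (isShortExact_iff.1 hfg).1.comp hf⟩
    obtain ⟨f, hf⟩ := key m le_rfl
    have hfe : Function.Injective (totMap (f ≫ e.hom)) :=
      (totMap_injective_of_isSplitMono e.hom).comp hf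
    obtain ⟨f₀, g, hfg⟩ := hF 0
    obtain ⟨-, h₂, h₃⟩ := isShortExact_iff.1 hfg
    have hg : ∀ v, totMap g v = 0 → v = 0 := fun v hv => by
      obtain ⟨u, rfl⟩ := (h₃ v).1 hv
      exact (congrArg (totMap f₀) ((isZero_iff _).1 h₀ u)).trans (map_zero _)
    obtain ⟨x, hx⟩ := (comp_surjective_iff g).2 h₂ (s 0)
      (⟨1, by rw [if_pos rfl]; trivial⟩ : ↥(if s 0 = s 0 then ⊤ else ⊥ : Submodule k k))
    have hx0 : x ≠ 0 := by
      rintro rfl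
      rw [map_zero] at hx
      exact zero_ne_one (congrArg Subtype.val hx)
    have hs : (F 1).shift (Pi.single (s 0) x) = 0 := hg _ (totMap_shift g _)
    refine (eq_of_shift_single_eq_zero (x := comp (f ≫ e.hom) (s 0) x) (fun h => hx0 ?_) ?_).symm
    · exact (comp_injective_iff _).2 hfe _ (h.trans (map_zero _).symm)
    · refine (congrArg _ (totMap_single (f ≫ e.hom) (s 0) x)).symm.trans ?_
      refine (totMap_shift (f ≫ e.hom) _).symm.trans ?_
      exact (congrArg (totMap (f ≫ e.hom)) hs).trans (map_zero _)
  · have h₁ := h.finrank_tot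
    rw [(hasCompositionSeries_uniserial k j (l + 1)).finrank_tot] at h₁
    omega

end NilRep

/-! ### Arcs -/

/-- Pointwise agreement already forces equal end points, so no transport between path types is
needed. -/
theorem OrientedArc.mk_eq_mk {X : Type u} [TopologicalSpace X] {x y x' y' : X} (γ : Path x y)
    (γ' : Path x' y') (h : ∀ t, γ t = γ' t) :
    (⟨(x, y), Path.Homotopic.Quotient.mk γ⟩ : OrientedArc X) =
      ⟨(x', y'), Path.Homotopic.Quotient.mk γ'⟩ := by
  obtain rfl : x = x' := by simpa using h 0
  obtain rfl : y = y' := by simpa using h 1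
  rw [show γ = γ' from Path.ext (funext h)]

theorem projArc_add_mul (n : ℕ) (a b m : ℤ) :
    projArc n (a + n * m) (b + n * m) = projArc n a b := by
  refine OrientedArc.mk_eq_mk (((straightPath _ _)).map (coverMap n).continuous)
    ((straightPath a b).map (coverMap n).continuous) fun t => Prod.ext ?_ rfl
  change ((AffineMap.lineMap (((a + n * m : ℤ)) : ℝ) ((b + n * m : ℤ) : ℝ) (t : ℝ) : ℝ) :
    AddCircle (n : ℝ)) = ((AffineMap.lineMap (a : ℝ) (b : ℝ) (t : ℝ) : ℝ) : AddCircle (n : ℝ))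
  rw [← sub_eq_zero, ← AddCircle.coe_sub, AddCircle.coe_eq_zero_iff]
  refine ⟨m, ?_⟩
  simp only [AffineMap.lineMap_apply_ring']
  push_cast
  ring

open Classical in
/-- The end point of the lift of the angular component of an arc in the annulus which starts
at a given point. -/
def OrientedArc.liftEnd {n : ℕ} (α : OrientedArc (Cyl n)) (x : ℝ) : ℝ :=
  if h : (x : AddCircle (n : ℝ)) = α.1.1.1 then
    ((AddCircle.isCoveringMap_coe (n : ℝ)).monodromy (α.2.map ⟨Prod.fst, continuous_fst⟩) ⟨x, h⟩).1
  -- A junk value: `x` does not lie over the starting point.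
  else 0

theorem liftEnd_projArc (n : ℕ) (a b : ℤ) : (projArc n a b).liftEnd a = b := by
  refine (dif_pos (show ((a : ℝ) : AddCircle (n : ℝ)) = (projArc n a b).1.1.1 from rfl)).trans ?_
  exact congrArg Subtype.val ((AddCircle.isCoveringMap_coe (n : ℝ)).monodromy_map
    (Path.Homotopic.Quotient.mk (Path.segment (a : ℝ) (b : ℝ))))

/-- Equality of starting points gives the congruence. After translating one lift so that both start
at `a`, the monodromy of the covering `ℝ → ℝ/nℤ` gives equal end points. -/
theorem projArc_eq_iff (n : ℕ) (a b c d : ℤ) :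
    projArc n a b = projArc n c d ↔ (a : ZMod n) = c ∧ b - a = d - c := by
  constructor
  · intro h
    have h₁ : ((a : ℝ) : AddCircle (n : ℝ)) = ((c : ℝ) : AddCircle (n : ℝ)) :=
      congrArg (fun α : OrientedArc (Cyl n) => α.1.1.1) h
    rw [← sub_eq_zero, ← AddCircle.coe_sub, AddCircle.coe_eq_zero_iff] at h₁
    obtain ⟨m, hm⟩ := h₁
    have hm' : a = c + n * m := by
      have : (a : ℝ) = ((c + n * m : ℤ) : ℝ) := by
        push_cast
        rw [zsmul_eq_mul] at hm
        linarith
      exact_mod_cast this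
    refine ⟨by rw [hm']; simp, ?_⟩
    rw [← projArc_add_mul n c d m, ← hm'] at h
    have h₂ := congrArg (fun α => OrientedArc.liftEnd α a) h
    simp only [liftEnd_projArc] at h₂
    have h₃ : b = d + n * m := by exact_mod_cast h₂
    rw [h₃, hm']
    ring
  · rintro ⟨h₁, h₂⟩
    obtain ⟨m, hm⟩ := (ZMod.intCast_eq_intCast_iff_dvd_sub c a n).1 h₁.symm
    rw [show a = c + n * m by linarith, show b = d + n * m by linarith, projArc_add_mul]

theorem AdmArc.proj_eq_iff (n : ℕ) {a b c d : ℤ} (h : a + 1 < b) (h' : c + 1 < d) :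
    AdmArc.proj n a b h = AdmArc.proj n c d h' ↔ (a : ZMod n) = c ∧ b - a = d - c :=
  Subtype.ext_iff.trans (projArc_eq_iff n a b c d)

/-! ### The translation quiver `ℤA_∞ / τⁿ` -/

namespace TransQuiver

variable {P : TransQuiver.{u}} {Q : TransQuiver.{v}}

theorem Iso.isStable (φ : P.Iso Q) (h : P.IsStable) : Q.IsStable := by
  have hs := φ.toEquiv.surjective
  refine ⟨fun x => ?_, fun x => ?_, fun x => ?_, fun x => ?_, fun x => ?_, fun x y hxy z => ?_⟩
  · obtain ⟨x, rfl⟩ := hs x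
    rw [φ.arrows_eq, h.no_loops]
  · obtain ⟨x, rfl⟩ := hs x
    refine ((h.finite_succ x).image φ.toEquiv).subset fun y hy => ?_
    obtain ⟨y, rfl⟩ := hs y
    exact ⟨y, by rwa [Set.mem_ofPred_eq, φ.arrows_eq] at hy, rfl⟩
  · obtain ⟨x, rfl⟩ := hs x
    refine ((h.finite_pred x).image φ.toEquiv).subset fun y hy => ?_
    obtain ⟨y, rfl⟩ := hs y
    exact ⟨y, by rwa [Set.mem_ofPred_eq, φ.arrows_eq] at hy, rfl⟩
  · obtain ⟨x, rfl⟩ := hs x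
    obtain ⟨y, hy, hy'⟩ := h.trans_total x
    refine ⟨φ.toEquiv y, (φ.trans_iff x y).2 hy, fun z hz => ?_⟩
    obtain ⟨z, rfl⟩ := hs z
    rw [hy' z ((φ.trans_iff x z).1 hz)]
  · obtain ⟨x, rfl⟩ := hs x
    obtain ⟨y, hy, hy'⟩ := h.trans_bijective x
    refine ⟨φ.toEquiv y, (φ.trans_iff y x).2 hy, fun z hz => ?_⟩
    obtain ⟨z, rfl⟩ := hs z
    rw [hy' z ((φ.trans_iff z x).1 hz)]
  · obtain ⟨x, rfl⟩ := hs x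
    obtain ⟨y, rfl⟩ := hs y
    obtain ⟨z, rfl⟩ := hs z
    rw [φ.arrows_eq, φ.arrows_eq, h.mesh x y ((φ.trans_iff x y).1 hxy)]

/-- Isomorphisms from a common source induce an isomorphism of the targets. -/
def Iso.symmTrans {R : TransQuiver.{w}} (φ : P.Iso Q) (ψ : P.Iso R) : Q.Iso R where
  toEquiv := φ.toEquiv.symm.trans ψ.toEquiv
  arrows_eq x y := by
    rw [Equiv.trans_apply, Equiv.trans_apply, ψ.arrows_eq, ← φ.arrows_eq, Equiv.apply_symm_apply,
      Equiv.apply_symm_apply]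
  trans_iff x y := by
    rw [Equiv.trans_apply, Equiv.trans_apply, ψ.trans_iff, ← φ.trans_iff, Equiv.apply_symm_apply,
      Equiv.apply_symm_apply]

end TransQuiver

open Classical in
/-- The stable tube of rank `n`. The vertex `(j, l)` stands for the uniserial representation with
socle at `j` and of length `l + 1`. -/
def tubeQuiver (n : ℕ) : TransQuiver.{0} where
  V := ZMod n × ℕ
  arrows x y := if (y.1 = x.1 ∧ y.2 = x.2 + 1) ∨ (y.1 = x.1 + 1 ∧ x.2 = y.2 + 1) then 1 else 0
  trans x y := x.1 = y.1 + 1 ∧ x.2 = y.2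

theorem tubeQuiver_isStable (n : ℕ) : (tubeQuiver n).IsStable where
  no_loops x := if_neg (by omega)
  finite_succ x := by
    -- For `x.2 = 0` the truncated second candidate is no successor, but only a finite set
    -- containing the successors is needed.
    refine (Set.toFinite {(x.1, x.2 + 1), (x.1 + 1, x.2 - 1)}).subset fun y hy => ?_
    rcases (ite_ne_right_iff.1 hy).1 with h | h
    · exact .inl (Prod.ext h.1 h.2)
    · exact .inr (Prod.ext h.1 (by simp [h.2]))
  finite_pred x := by
    refine (Set.toFinite {(x.1, x.2 - 1), (x.1 - 1, x.2 + 1)}).subset fun y hy => ?_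
    rcases (ite_ne_right_iff.1 hy).1 with h | h
    · exact .inl (Prod.ext h.1.symm (by simp [h.2]))
    · exact .inr (Prod.ext (by simp [h.1]) h.2)
  trans_total x := ⟨(x.1 - 1, x.2), ⟨by simp, rfl⟩, fun y hy => Prod.ext (by simp [hy.1]) hy.2.symm⟩
  trans_bijective y := ⟨(y.1 + 1, y.2), ⟨rfl, rfl⟩, fun x hx => Prod.ext hx.1 hx.2⟩
  mesh := by
    rintro ⟨i, m⟩ ⟨j, l⟩ ⟨hi, hm⟩ ⟨j', l'⟩
    obtain rfl : i = j + 1 := hi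
    obtain rfl : m = l := hm
    refine if_congr ?_ rfl rfl
    simp only [add_left_inj]
    constructor
    -- The mesh relation exchanges the two kinds of arrows.
    · rintro (⟨rfl, rfl⟩ | ⟨rfl, rfl⟩)
      · exact .inr ⟨rfl, rfl⟩
      · exact .inl ⟨rfl, rfl⟩
    · rintro (⟨rfl, rfl⟩ | ⟨rfl, rfl⟩)
      · exact .inr ⟨rfl, rfl⟩
      · exact .inl ⟨rfl, rfl⟩

/-- The arc which corresponds to a vertex of the tube. -/
def arcOfVertex (n : ℕ) (x : ZMod n × ℕ) : AdmArc n :=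
  -- With `a = j - 1` and `b = j + l + 1`, the factors `S_{a+1}, …, S_{b-1}` run from `S_j` to
  -- `S_{j+l}`.
  AdmArc.proj n (x.1.cast - 1) (x.1.cast + x.2 + 1) (by omega)

theorem arcOfVertex_eq_proj_iff (n : ℕ) (x : ZMod n × ℕ) {a b : ℤ} (h : a + 1 < b) :
    arcOfVertex n x = AdmArc.proj n a b h ↔ x.1 = a + 1 ∧ b = a + x.2 + 2 := by
  rw [arcOfVertex, AdmArc.proj_eq_iff]
  refine and_congr ?_ (by omega)
  push_cast
  rw [sub_eq_iff_eq_add]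

theorem arcOfVertex_bijective (n : ℕ) : Function.Bijective (arcOfVertex n) := by
  constructor
  · intro x y h
    have := (arcOfVertex_eq_proj_iff n x _).1 h
    push_cast at this
    rw [sub_add_cancel] at this
    exact Prod.ext this.1 (by omega)
  · rintro ⟨_, a, b, h, rfl⟩
    exact ⟨((a + 1 : ℤ), (b - a - 2).toNat), (arcOfVertex_eq_proj_iff n _ h).2
      ⟨by push_cast; rfl, by simp only; omega⟩⟩

/-- Moving the right end point lengthens the object over the same socle; moving the left one passes
to the quotient by the socle. -/
theorem arcOfVertex_hasArrow_iff (n : ℕ) (x y : ZMod n × ℕ) :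
    (arcOfVertex n x).HasArrow (arcOfVertex n y) ↔
      (y.1 = x.1 ∧ y.2 = x.2 + 1) ∨ (y.1 = x.1 + 1 ∧ x.2 = y.2 + 1) := by
  constructor
  · rintro ⟨a, b, c, d, h, h', hx, hy, hcd⟩
    obtain ⟨hx₁, hx₂⟩ := (arcOfVertex_eq_proj_iff n x h).1 hx.symm
    obtain ⟨hy₁, hy₂⟩ := (arcOfVertex_eq_proj_iff n y h').1 hy.symm
    rcases hcd with ⟨rfl, rfl⟩ | ⟨rfl, rfl⟩
    · exact .inr ⟨by rw [hx₁, hy₁]; push_cast; ring, by omega⟩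
    · exact .inl ⟨by rw [hx₁, hy₁], by omega⟩
  · intro hxy
    obtain ⟨j, l⟩ := x
    obtain ⟨j', l'⟩ := y
    rcases hxy with ⟨h₁, h₂⟩ | ⟨h₁, h₂⟩ <;> simp only at h₁ h₂
    · refine ⟨j.cast - 1, j.cast + l + 1, j.cast - 1, j.cast + l + 2, by omega, by omega, ?_, ?_,
        .inr ⟨rfl, by ring⟩⟩ <;> rw [eq_comm, arcOfVertex_eq_proj_iff] <;> push_cast
      · exact ⟨by simp, by ring⟩
      · exact ⟨by simp [h₁], by simp only [h₂]; push_cast; ring⟩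
    · refine ⟨j.cast - 1, j.cast + l + 1, j.cast, j.cast + l + 1, by omega, by omega, ?_, ?_,
        .inl ⟨by ring, rfl⟩⟩ <;> rw [eq_comm, arcOfVertex_eq_proj_iff] <;> push_cast
      · exact ⟨by simp, by ring⟩
      · exact ⟨by simp [h₁], by simp only [h₂]; push_cast; ring⟩

/-- The quiver of arcs in the annulus is a tube. -/
def tubeIsoArcQuiver (n : ℕ) : (tubeQuiver n).Iso (arcQuiver n) where
  toEquiv := Equiv.ofBijective (arcOfVertex n) (arcOfVertex_bijective n)
  arrows_eq x y := by
    classical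
    exact if_congr (arcOfVertex_hasArrow_iff n x y) rfl rfl
  trans_iff x y := by
    constructor
    · rintro ⟨a, b, h, hx, hy⟩
      obtain ⟨hx₁, hx₂⟩ := (arcOfVertex_eq_proj_iff n x h).1 hx
      obtain ⟨hy₁, hy₂⟩ := (arcOfVertex_eq_proj_iff n y _).1 hy
      exact ⟨by rw [hx₁, hy₁]; push_cast; ring, by omega⟩
    · intro hxy
      obtain ⟨j, l⟩ := x
      obtain ⟨j', l'⟩ := y
      obtain ⟨h₁, h₂⟩ : j = j' + 1 ∧ l = l' := hxy
      refine ⟨j.cast - 1, j.cast + l + 1, by omega, rfl, ?_⟩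
      refine (arcOfVertex_eq_proj_iff n (j', l') _).2 ?_
      push_cast
      exact ⟨by simp [h₁], by simp only [h₂]; ring⟩

namespace NilRep

variable (k : Type u) [Field k] (n : ℕ)

/-- The indecomposable object which corresponds to a vertex of the tube. -/
def indOfVertex (x : ZMod n × ℕ) : Ind k n :=
  Ind.mk (uniserial k x.1 (x.2 + 1)) (indecomposable_uniserial k x.1 x.2)

variable {k n}

theorem Ind.mk_eq_mk_iff {X Y : NilRep k n} (hX : Indecomposable X) (hY : Indecomposable Y) :
    Ind.mk X hX = Ind.mk Y hY ↔ Nonempty (X ≅ Y) := Quotient.eq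

theorem indOfVertex_bijective : Function.Bijective (indOfVertex k n) := by
  constructor
  · intro x y h
    obtain ⟨e⟩ := (Ind.mk_eq_mk_iff _ _).1 h
    exact Prod.ext (eq_of_iso e).1 (eq_of_iso e).2
  · intro X
    induction X using Quotient.inductionOn with
    | h X =>
      obtain ⟨j, l, ⟨e⟩⟩ := exists_iso_uniserial X.2
      exact ⟨(j, l), (Ind.mk_eq_mk_iff _ X.2).2 ⟨e.symm⟩⟩

end NilRep

open NilRep

/-- The Auslander-Reiten quiver of the category of nilpotent representations is a tube. -/
def tubeIsoARQuiver (k : Type u) [Field k] (n : ℕ) : (tubeQuiver n).Iso (arQuiver k n) where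
  toEquiv := Equiv.ofBijective (indOfVertex k n) indOfVertex_bijective
  arrows_eq x y := irrDim_uniserial x.1 y.1 x.2 y.2
  trans_iff x y := by
    constructor
    · rintro ⟨X, E, Z, hX, hZ, f, g, hfg, hy, hx⟩
      obtain ⟨e⟩ := (Ind.mk_eq_mk_iff _ _).1 hy
      obtain ⟨e'⟩ := (Ind.mk_eq_mk_iff _ _).1 hx
      -- Any almost split sequence with this left-hand term has the standard right-hand term, so the
      -- translation is read off from the standard sequences.
      obtain ⟨e''⟩ := hfg.nonempty_iso e.symm
      exact eq_of_iso (e' ≪≫ e'')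
    · obtain ⟨j, l⟩ := x
      obtain ⟨j', l'⟩ := y
      rintro ⟨h₁, h₂⟩
      obtain rfl : j = j' + 1 := h₁
      obtain rfl : l = l' := h₂
      exact ⟨_, _, _, indecomposable_uniserial k j' l, indecomposable_uniserial k (j' + 1) l,
        asLeft k j' l, asRight k j' l, isAlmostSplit_as j' l, rfl, rfl⟩

/-- Among indecomposables, the first factor and the length of a composition series already determine
the object. -/
theorem NilRep.nonempty_iso_uniserial_iff {k : Type u} [Field k] {n : ℕ} [NeZero n]
    {M : NilRep k n} (hM : Indecomposable M) (j : ZMod n) (l : ℕ) :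
    Nonempty (uniserial k j (l + 1) ≅ M) ↔
      M.HasCompositionSeries (l + 1) fun t => j + (t : ℕ) := by
  constructor
  · rintro ⟨e⟩
    exact hasCompositionSeries_of_iso e (hasCompositionSeries_uniserial k j (l + 1))
  · intro h
    obtain ⟨j', l', ⟨e⟩⟩ := exists_iso_uniserial hM
    obtain ⟨h₁, h₂⟩ := (hasCompositionSeries_of_iso e h).eq_of_uniserial
    rw [Fin.val_zero, Nat.cast_zero, add_zero] at h₁
    subst h₁ h₂
    exact ⟨e.symm⟩

end

/-- The quiver of admissible arcs in the annulus and the Auslander-Reiten quiver of the tube are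
stable translation quivers, and there is an isomorphism between them which takes `π_n([a, b])` to
the isomorphism class `M[a, b]` of indecomposable objects: the class of those indecomposable objects
that have a composition series with factors `S_{a+1}, S_{a+2}, …, S_{b-1}` (from the socle upwards,
indices modulo `n`). -/
theorem lemma2p5 (k : Type u) [Field k] [IsAlgClosed k] (n : ℕ) [NeZero n] :
    (arcQuiver n).IsStable ∧ (arQuiver k n).IsStable ∧
      ∃ φ : TransQuiver.Iso (arcQuiver n) (arQuiver k n),
        ∀ (a b : ℤ) (h : a + 1 < b) (M : NilRep k n) (hM : Indecomposable M),
          φ.toEquiv (AdmArc.proj n a b h) = NilRep.Ind.mk M hM ↔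
            M.HasCompositionSeries (b - a - 1).toNat
              (fun t => ((a + 1 + (t : ℕ) : ℤ) : ZMod n)) := by
  refine ⟨(tubeIsoArcQuiver n).isStable (tubeQuiver_isStable n),
    (tubeIsoARQuiver k n).isStable (tubeQuiver_isStable n),
    (tubeIsoArcQuiver n).symmTrans (tubeIsoARQuiver k n), fun a b h M hM => ?_⟩
  -- Admissibility means `b - a ≥ 2`; the number of factors is then `l + 1`, matching the
  -- length-minus-one coordinate of the tube.
  obtain ⟨l, rfl⟩ : ∃ l : ℕ, b = a + l + 2 := ⟨(b - a - 2).toNat, by omega⟩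
  have hv : (tubeIsoArcQuiver n).toEquiv.symm (AdmArc.proj n a (a + l + 2) h) =
      (((a + 1 : ℤ) : ZMod n), l) :=
    (Equiv.symm_apply_eq _).2 ((arcOfVertex_eq_proj_iff n _ h).2 ⟨by push_cast; rfl, rfl⟩).symm
  have hφ : ((tubeIsoArcQuiver n).symmTrans (tubeIsoARQuiver k n)).toEquiv
      (AdmArc.proj n a (a + l + 2) h) = NilRep.indOfVertex k n (((a + 1 : ℤ) : ZMod n), l) :=
    congrArg (tubeIsoARQuiver k n).toEquiv hv
  rw [hφ]
  refine ((NilRep.Ind.mk_eq_mk_iff _ hM).trans (NilRep.nonempty_iso_uniserial_iff hM _ l)).trans ?_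
  have hl : (a + l + 2 - a - 1).toNat = l + 1 := by omega
  rw [hl]
  push_cast
  rfl
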